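/- Let $S$ be a finite state space, $\gamma\in(0,1)$, $P\in\mathbb R^{S\times S}$ a transition (row-stochastic) matrix, $M\in\mathbb R^{S\times S}$ symmetric positive definite, and for each $i\in S$ let $\nu_i$ be the law of a single observed reward at state $i$, a probability law on $\mathbb R$ with finite variance and mean $b_i$; assume $b\neq 0$. Put $A=I-\gamma P$, $v=A^{-1}b$ and $\|x\|_M^2=x^\top A^\top M A x$. All of these are fixed, independently of the sample size. For every $n\ge 1$, let $\hat P$ and $\hat b$ be estimated from $n$ samples per state: the rows $\hat P_i$ of $\hat P$ are independent, with $n\hat P_i$ multinomial with $n$ trials and cell probabilities $P_i$; $\hat b_i$ is the average of $n$ i.i.d. rewards of law $\nu_i$; and $\hat P$ and $\hat b$ are independent. Put $\hat v=(I-\gamma\hat P)^{-1}\hat b$ and $\hat Y=\gamma(P-\hat P)A^{-1}$. Define $$\mathrm{MSE}(\varepsilon)=\mathbb E\,\|v-\varepsilon\hat v\|_M^2 ,$$ $$\varepsilon^\circ=\frac{\mathbb E\left[b^\top\left(M+\tfrac12\left(M\hat Y^2+(\hat Y^\top)^2M\right)\right)b\right]}{\mathbb E\left[b^\top\hat Q\,b+\mathrm{tr}\left(\mathrm{cov}[\hat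 b]\,\hat Q\right)\right]},\qquad \hat Q=M+\hat Y^\top M\hat Y+M\hat Y^2+(\hat Y^\top)^2M ,$$ $$\eta=\frac{\mathrm{MSE}(1)-\mathrm{MSE}(\varepsilon^\circ)}{\mathrm{MSE}(1)} .$$ Then all these expectations are finite for every $n\ge1$, and, for all large $n$, the denominator of $\varepsilon^\circ$ is positive and $\mathrm{MSE}(1)=0$ implies $\mathrm{MSE}(\varepsilon^\circ)=0$ (in this degenerate case $\eta$ is read as $0$). The relative error reduction satisfies $$\eta=O(1/n)\qquad(n\to\infty).$$ -/

import Mathlib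

open MeasureTheory ProbabilityTheory Matrix Filter Asymptotics Finset

noncomputable section

namespace PolicyEval

variable {S : Type*} [Fintype S] [DecidableEq S]

/-- The multinomial law with `n` trials and cell probabilities `p`: the law of the count vector of
`n` independent draws `s 0, …, s (n - 1)` from `p`. -/
def multinomialLaw (n : ℕ) (p : S → ℝ) : Measure (S → ℕ) :=
  ∑ s : Fin n → S, ENNReal.ofReal (∏ k, p (s k)) •
    Measure.dirac (fun j => #{k : Fin n | s k = j})

/-- Data observed with `n` samples per state: `counts i ω j` is the number of observed transitions
from `i` to `j`, and `reward i k ω` is the `k`-th observed reward at state `i`. -/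
structure SampleData (S Ω : Type*) (n : ℕ) where
  counts : S → Ω → S → ℕ
  reward : S → Fin n → Ω → ℝ

variable {Ω : Type*} {n : ℕ}

/-- The empirical transition matrix. -/
def SampleData.Phat (D : SampleData S Ω n) (ω : Ω) : Matrix S S ℝ :=
  Matrix.of fun i j => (D.counts i ω j : ℝ) / n

/-- The empirical reward vector: at each state, the average of the observed rewards. -/
def SampleData.bhat (D : SampleData S Ω n) (ω : Ω) : S → ℝ :=
  fun i => (∑ k, D.reward i k ω) / n

/-- The sampling assumption, for the transition matrix `P` and the laws `ν i` of a single observed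
reward at state `i`: the transition counts of different states are independent and multinomial, the
`n` observed rewards at each state are i.i.d., and the empirical transition matrix (equivalently,
the family of all counts) is independent of the empirical reward vector. -/
structure SampleData.Assumption [MeasurableSpace Ω] (D : SampleData S Ω n)
    (μ : Measure Ω) (P : Matrix S S ℝ) (ν : S → Measure ℝ) : Prop where
  counts_law : ∀ i, HasLaw (D.counts i) (multinomialLaw n (P i)) μ
  counts_indep : iIndepFun D.counts μ
  reward_law : ∀ i k, HasLaw (D.reward i k) (ν i) μ
  reward_indep : ∀ i, iIndepFun (D.reward i) μ
  indep : IndepFun (fun ω i => D.counts i ω) D.bhat μ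

/-- `A = I - γ P`. -/
def opA (γ : ℝ) (P : Matrix S S ℝ) : Matrix S S ℝ := 1 - γ • P

/-- The solution `v` of `(I - γ P) v = b`. -/
def value (γ : ℝ) (P : Matrix S S ℝ) (b : S → ℝ) : S → ℝ := (opA γ P)⁻¹ *ᵥ b

/-- The squared norm `xᵀ Aᵀ M A x`. -/
def normSq (γ : ℝ) (P M : Matrix S S ℝ) (x : S → ℝ) : ℝ :=
  x ⬝ᵥ (((opA γ P)ᵀ * M * opA γ P) *ᵥ x)

/-- The squared error of the augmented estimate `ε (I - γ P̂)⁻¹ b̂`. -/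
def sqError (D : SampleData S Ω n) (γ : ℝ) (P M : Matrix S S ℝ) (b : S → ℝ) (ε : ℝ) (ω : Ω) : ℝ :=
  normSq γ P M (value γ P b - ε • value γ (D.Phat ω) (D.bhat ω))

/-- `Ŷ = γ (P - P̂) A⁻¹`. -/
def Yhat (D : SampleData S Ω n) (γ : ℝ) (P : Matrix S S ℝ) (ω : Ω) : Matrix S S ℝ :=
  (γ • (P - D.Phat ω)) * (opA γ P)⁻¹

/-- The random variable whose expectation is the numerator of `ε°`. -/
def numVar (D : SampleData S Ω n) (γ : ℝ) (P M : Matrix S S ℝ) (b : S → ℝ) (ω : Ω) : ℝ :=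
  let Y := Yhat D γ P ω
  b ⬝ᵥ ((M + (1 / 2 : ℝ) • (M * Y ^ 2 + Yᵀ ^ 2 * M)) *ᵥ b)

variable [MeasurableSpace Ω]

/-- The mean square error of the augmented estimate. -/
def MSE (μ : Measure Ω) (D : SampleData S Ω n) (γ : ℝ) (P M : Matrix S S ℝ) (b : S → ℝ)
    (ε : ℝ) : ℝ :=
  ∫ ω, sqError D γ P M b ε ω ∂μ

/-- The covariance matrix of `b̂`. -/
def covBhat (μ : Measure Ω) (D : SampleData S Ω n) : Matrix S S ℝ :=
  Matrix.of fun i j => cov[fun ω => D.bhat ω i, fun ω => D.bhat ω j; μ]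

/-- The random variable whose expectation is the denominator of `ε°`. -/
def denVar (μ : Measure Ω) (D : SampleData S Ω n) (γ : ℝ) (P M : Matrix S S ℝ) (b : S → ℝ)
    (ω : Ω) : ℝ :=
  let Y := Yhat D γ P ω
  let Q := M + Yᵀ * M * Y + M * Y ^ 2 + Yᵀ ^ 2 * M
  b ⬝ᵥ (Q *ᵥ b) + (covBhat μ D * Q).trace

/-- The second-order approximation `ε°` of the optimal augmentation factor. -/
def epsCirc (μ : Measure Ω) (D : SampleData S Ω n) (γ : ℝ) (P M : Matrix S S ℝ) (b : S → ℝ) : ℝ :=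
  (∫ ω, numVar D γ P M b ω ∂μ) / ∫ ω, denVar μ D γ P M b ω ∂μ

/-- The relative error reduction `η = (MSE(1) - MSE(ε°)) / MSE(1)`. -/
def relReduction (μ : Measure Ω) (D : SampleData S Ω n) (γ : ℝ) (P M : Matrix S S ℝ)
    (b : S → ℝ) : ℝ :=
  (MSE μ D γ P M b 1 - MSE μ D γ P M b (epsCirc μ D γ P M b)) / MSE μ D γ P M b 1

end PolicyEval

end

/-! Everything is carried to the image of `A`. With `Y = γ (P - P̂) A⁻¹` one has `I - γ P̂ = (1 + Y)
A` exactly, so the error `e = A v̂ - b` (`fullErr`) equals `(1 + Y)⁻¹ u`, where `u = b̂ - b - Y b`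
(`linErr`) is the first-order error. Since `P` and `P̂` are both stochastic, `1 + Y` and `(1 + Y)⁻¹`
have norms bounded by constants depending on `γ` alone. Hence `e` and `u` are comparable pointwise,
and no Neumann series or smallness of `Y` is needed. Moreover `u` has mean zero and the sum of its
squared coordinates has expectation exactly `V / n`, with `V = errVar` independent of `n`.

The identity `A (v - ε v̂) = (1 - ε) (b + e) - e` gives `MSE(ε) = MSE(1) - 2 (1 - ε) E[eᵀ M (b + e)]
+ (1 - ε)² E[(b + e)ᵀ M (b + e)]`. The last expectation is bounded. The cross expectation is
`O(1/n)`: in `e = u - (1 + Y)⁻¹ Y u` the linear part averages out, and what remains is quadratic in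
`(Y, u)` (`abs_integral_cross_le`). Numerator and denominator of `ε°` differ only by terms quadratic
in `Y` and by a trace against `cov[b̂]`, so `1 - ε° = O(1/n)` (`abs_one_sub_epsCirc_le`). Thus
`MSE(1) - MSE(ε°) = O(1/n²)`.

If `V > 0`, comparability of `e` and `u` gives `MSE(1) ≥ const / n` (`le_MSE_one`), and the quotient
is `O(1/n)`. If `V = 0`, then almost surely `u = 0` and `Y b = 0`, and `cov[b̂] = 0`; so `MSE(1) =
0`, and `ε° = 1` for large `n`. -/

namespace PolicyEval

/-! ### Norm estimates: the sup norm on vectors and its operator norm on matrices. -/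

section LinearAlgebra

open scoped Matrix.Norms.Operator

variable {S : Type*} [Fintype S]

lemma matrix_norm_le_of_row_sum_le {Q : Matrix S S ℝ} {c : ℝ} (hc : 0 ≤ c)
    (h : ∀ i, ∑ j, |Q i j| ≤ c) : ‖Q‖ ≤ c := by
  lift c to NNReal using hc
  rw [Matrix.linfty_opNorm_def, NNReal.coe_le_coe, Finset.sup_le_iff]
  intro i _
  rw [← NNReal.coe_le_coe]
  simpa using h i

lemma matrix_norm_le_sum (Q : Matrix S S ℝ) : ‖Q‖ ≤ ∑ i, ∑ j, |Q i j| :=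
  matrix_norm_le_of_row_sum_le (by positivity) fun i =>
    Finset.single_le_sum (f := fun i => ∑ j, |Q i j|) (fun _ _ => by positivity)
      (Finset.mem_univ i)

/-- Cauchy–Schwarz over all entries. Second moments of single entries are computable, and constants
depending on `S` do not affect the rate. -/
lemma matrix_norm_sq_le (Q : Matrix S S ℝ) :
    ‖Q‖ ^ 2 ≤ (Fintype.card S : ℝ) ^ 2 * ∑ i, ∑ j, Q i j ^ 2 := by
  have h := sq_sum_le_card_mul_sum_sq (s := (Finset.univ : Finset (S × S)))
    (f := fun x => |Q x.1 x.2|)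
  simp only [Fintype.sum_prod_type, sq_abs, Finset.card_univ, Fintype.card_prod] at h
  calc ‖Q‖ ^ 2 ≤ (∑ i, ∑ j, |Q i j|) ^ 2 := by
        gcongr
        exact matrix_norm_le_sum Q
    _ ≤ _ := h
    _ = _ := by push_cast; ring

lemma vec_norm_sq_le (x : S → ℝ) : ‖x‖ ^ 2 ≤ ∑ i, x i ^ 2 := by
  have h0 : 0 ≤ ∑ i, x i ^ 2 := by positivity
  have h : ‖x‖ ≤ Real.sqrt (∑ i, x i ^ 2) := by
    rw [pi_norm_le_iff_of_nonneg (Real.sqrt_nonneg _)]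
    intro i
    rw [Real.norm_eq_abs]
    apply Real.abs_le_sqrt
    exact Finset.single_le_sum (f := fun i => x i ^ 2) (fun _ _ => by positivity)
      (Finset.mem_univ i)
  calc ‖x‖ ^ 2 ≤ Real.sqrt (∑ i, x i ^ 2) ^ 2 := by gcongr
    _ = _ := Real.sq_sqrt h0

lemma sum_sq_le_vec_norm_sq (x : S → ℝ) : ∑ i, x i ^ 2 ≤ Fintype.card S * ‖x‖ ^ 2 := by
  have h : ∀ i ∈ (Finset.univ : Finset S), x i ^ 2 ≤ ‖x‖ ^ 2 := fun i _ => by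
    rw [← sq_abs]
    gcongr
    exact norm_le_pi_norm x i
  simpa using Finset.sum_le_card_nsmul _ _ _ h

lemma abs_dotProduct_mulVec_le (M : Matrix S S ℝ) (x y : S → ℝ) :
    |x ⬝ᵥ (M *ᵥ y)| ≤ (Fintype.card S * ‖M‖) * (‖x‖ * ‖y‖) := by
  have h : ∀ i ∈ (Finset.univ : Finset S), |x i * (M *ᵥ y) i| ≤ ‖x‖ * (‖M‖ * ‖y‖) :=
    fun i _ => by
      rw [abs_mul]
      gcongr
      · exact norm_le_pi_norm x i
      · exact (norm_le_pi_norm (M *ᵥ y) i).trans (Matrix.linfty_opNorm_mulVec M y)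
  calc |x ⬝ᵥ (M *ᵥ y)| ≤ ∑ i, |x i * (M *ᵥ y) i| := Finset.abs_sum_le_sum_abs _ _
    _ ≤ Fintype.card S * (‖x‖ * (‖M‖ * ‖y‖)) := by
      simpa using Finset.sum_le_card_nsmul _ _ _ h
    _ = _ := by ring

/-- The form attains a positive minimum on the compact unit sphere; homogeneity does the rest. The
sphere is empty when `S` is, hence the case split. -/
lemma exists_pos_mul_norm_sq_le {M : Matrix S S ℝ} (hM : M.PosDef) :
    ∃ c : ℝ, 0 < c ∧ ∀ x : S → ℝ, c * ‖x‖ ^ 2 ≤ x ⬝ᵥ (M *ᵥ x) := by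
  have hcont : Continuous fun x : S → ℝ => x ⬝ᵥ (M *ᵥ x) := by
    unfold dotProduct mulVec dotProduct
    fun_prop
  have hpos : ∀ x : S → ℝ, x ≠ 0 → 0 < x ⬝ᵥ (M *ᵥ x) := fun x hx => by
    simpa using hM.dotProduct_mulVec_pos hx
  rcases (Metric.sphere (0 : S → ℝ) 1).eq_empty_or_nonempty with he | hne
  · refine ⟨1, one_pos, fun x => ?_⟩
    by_cases hx : x = 0
    · simp [hx]
    · exfalso
      have : (‖x‖⁻¹ • x) ∈ Metric.sphere (0 : S → ℝ) 1 := by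
        simp [norm_smul, hx]
      rw [he] at this
      exact this
  · obtain ⟨x₀, hx₀, hmin⟩ := (isCompact_sphere (0 : S → ℝ) 1).exists_isMinOn hne
      hcont.continuousOn
    have hx₀' : x₀ ≠ 0 := by
      rintro rfl
      simp at hx₀
    refine ⟨_, hpos x₀ hx₀', fun x => ?_⟩
    by_cases hx : x = 0
    · simp [hx]
    have hn : 0 < ‖x‖ := norm_pos_iff.2 hx
    have h1 : (‖x‖⁻¹ • x) ∈ Metric.sphere (0 : S → ℝ) 1 := by
      simp [norm_smul, hx]
    have h2 := hmin h1
    simp only [Set.mem_ofPred_eq, mulVec_smul, dotProduct_smul, smul_dotProduct,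
      smul_eq_mul] at h2
    calc _ ≤ ‖x‖⁻¹ * (‖x‖⁻¹ * (x ⬝ᵥ (M *ᵥ x))) * ‖x‖ ^ 2 := by gcongr
      _ = _ := by field_simp

lemma dotProduct_mulVec_symm {M : Matrix S S ℝ} (hM : M.PosDef) (x y : S → ℝ) :
    x ⬝ᵥ (M *ᵥ y) = y ⬝ᵥ (M *ᵥ x) := by
  have h : Mᵀ = M := by simpa using hM.isHermitian.eq
  rw [dotProduct_mulVec, ← mulVec_transpose, h, dotProduct_comm]

variable [DecidableEq S]

lemma norm_le_one_of_mem_rowStochastic {Q : Matrix S S ℝ} (hQ : Q ∈ rowStochastic ℝ S) :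
    ‖Q‖ ≤ 1 := by
  refine matrix_norm_le_of_row_sum_le zero_le_one fun i => ?_
  rw [← sum_row_of_mem_rowStochastic hQ i]
  exact (Finset.sum_congr rfl fun j _ => abs_of_nonneg (nonneg_of_mem_rowStochastic hQ)).le

lemma norm_smul_rowStochastic_le {γ : ℝ} (hγ : γ ∈ Set.Ioo (0 : ℝ) 1) {Q : Matrix S S ℝ}
    (hQ : Q ∈ rowStochastic ℝ S) : ‖γ • Q‖ ≤ γ := by
  rw [norm_smul, Real.norm_of_nonneg hγ.1.le]
  exact mul_le_of_le_one_right hγ.1.le (norm_le_one_of_mem_rowStochastic hQ)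

lemma isUnit_det_opA {γ : ℝ} (hγ : γ ∈ Set.Ioo (0 : ℝ) 1) {Q : Matrix S S ℝ}
    (hQ : Q ∈ rowStochastic ℝ S) : IsUnit (opA γ Q).det := by
  rw [← Matrix.isUnit_iff_isUnit_det]
  exact isUnit_one_sub_of_norm_lt_one ((norm_smul_rowStochastic_le hγ hQ).trans_lt hγ.2)

lemma matrix_norm_one_le : ‖(1 : Matrix S S ℝ)‖ ≤ 1 :=
  norm_le_one_of_mem_rowStochastic (one_mem _)

lemma norm_opA_le {γ : ℝ} (hγ : γ ∈ Set.Ioo (0 : ℝ) 1) {Q : Matrix S S ℝ}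
    (hQ : Q ∈ rowStochastic ℝ S) : ‖opA γ Q‖ ≤ 2 := by
  have h1 := matrix_norm_one_le (S := S)
  have h2 := norm_smul_rowStochastic_le hγ hQ
  have h3 := norm_sub_le (1 : Matrix S S ℝ) (γ • Q)
  have h4 := hγ.2
  unfold opA
  linarith

lemma norm_inv_opA_le {γ : ℝ} (hγ : γ ∈ Set.Ioo (0 : ℝ) 1) {Q : Matrix S S ℝ}
    (hQ : Q ∈ rowStochastic ℝ S) : ‖(opA γ Q)⁻¹‖ ≤ (1 - γ)⁻¹ := by
  set B := (opA γ Q)⁻¹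
  have h : B * opA γ Q = 1 := nonsing_inv_mul _ (isUnit_det_opA hγ hQ)
  -- This fixed-point identity gives `‖B‖ ≤ 1 + γ ‖B‖`, which is solved for `‖B‖`.
  have h' : B = 1 + B * (γ • Q) := by
    rw [opA, mul_sub, mul_one] at h
    rw [← h, sub_add_cancel]
  have h0 := hγ.2
  have h1 : ‖B‖ ≤ 1 + ‖B‖ * γ := by
    calc ‖B‖ = ‖1 + B * (γ • Q)‖ := by rw [← h']
      _ ≤ ‖(1 : Matrix S S ℝ)‖ + ‖B‖ * ‖γ • Q‖ :=
        (norm_add_le _ _).trans (by gcongr; exact norm_mul_le _ _)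
      _ ≤ _ := by
        gcongr
        · exact matrix_norm_one_le
        · exact norm_smul_rowStochastic_le hγ hQ
  rw [← one_div, le_div_iff₀ (by linarith)]
  linarith

end LinearAlgebra

/-! ### Moments of linear functionals of a multinomial vector. -/

section Multinomial

variable {S : Type*} [Fintype S]

lemma sum_fin_succ_fun (n : ℕ) (f : (Fin (n + 1) → S) → ℝ) :
    ∑ s, f s = ∑ j, ∑ s : Fin n → S, f (Fin.cons j s) := by
  rw [← (Fin.consEquiv fun _ => S).sum_comp, Fintype.sum_prod_type]
  rfl

lemma sum_draws_one {p : S → ℝ} (hp : ∑ j, p j = 1) (n : ℕ) :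
    ∑ s : Fin n → S, ∏ k, p (s k) = 1 := by
  induction n with
  | zero => simp
  | succ n ih =>
    rw [sum_fin_succ_fun]
    simp [Fin.prod_univ_succ, ← Finset.mul_sum, ih, hp]

lemma sum_draws_linear {p g : S → ℝ} (hp : ∑ j, p j = 1) (hg : ∑ j, p j * g j = 0) (n : ℕ) :
    ∑ s : Fin n → S, (∏ k, p (s k)) * ∑ k, g (s k) = 0 := by
  induction n with
  | zero => simp
  | succ n ih =>
    rw [sum_fin_succ_fun]
    have h : ∀ j, ∑ s : Fin n → S, (p j * ∏ k, p (s k)) * (g j + ∑ k, g (s k)) = p j * g j := by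
      intro j
      calc _ = (p j * g j) * (∑ s : Fin n → S, ∏ k, p (s k)) +
            p j * ∑ s : Fin n → S, (∏ k, p (s k)) * ∑ k, g (s k) := by
            rw [Finset.mul_sum, Finset.mul_sum, ← Finset.sum_add_distrib]
            exact Finset.sum_congr rfl fun s _ => by ring
        _ = _ := by rw [ih, sum_draws_one hp]; ring
    simp [Fin.prod_univ_succ, Fin.sum_univ_succ, h, hg]

/-- Variances of independent centred draws add: on splitting off the first draw, the cross term
vanishes by `sum_draws_linear`. -/
lemma sum_draws_sq {p g : S → ℝ} (hp : ∑ j, p j = 1) (hg : ∑ j, p j * g j = 0) (n : ℕ) :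
    ∑ s : Fin n → S, (∏ k, p (s k)) * (∑ k, g (s k)) ^ 2 = n * ∑ j, p j * g j ^ 2 := by
  induction n with
  | zero => simp
  | succ n ih =>
    rw [sum_fin_succ_fun]
    have h : ∀ j, ∑ s : Fin n → S, (p j * ∏ k, p (s k)) * (g j + ∑ k, g (s k)) ^ 2 =
        p j * g j ^ 2 + p j * (n * ∑ j, p j * g j ^ 2) := by
      intro j
      calc _ = (p j * g j ^ 2) * (∑ s : Fin n → S, ∏ k, p (s k)) +
            (2 * (p j * g j)) * (∑ s : Fin n → S, (∏ k, p (s k)) * ∑ k, g (s k)) +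
            p j * ∑ s : Fin n → S, (∏ k, p (s k)) * (∑ k, g (s k)) ^ 2 := by
            rw [Finset.mul_sum, Finset.mul_sum, Finset.mul_sum, ← Finset.sum_add_distrib,
              ← Finset.sum_add_distrib]
            exact Finset.sum_congr rfl fun s _ => by ring
        _ = _ := by rw [ih, sum_draws_one hp, sum_draws_linear hp hg]; ring
    simp only [Fin.prod_univ_succ, Fin.sum_univ_succ, Fin.cons_zero, Fin.cons_succ, h]
    rw [Finset.sum_add_distrib, ← Finset.sum_mul, hp]
    push_cast
    ring

lemma sum_mul_sub_mean {p : S → ℝ} (hp : ∑ j, p j = 1) (g : S → ℝ) :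
    ∑ j, p j * (g j - ∑ j, p j * g j) = 0 := by
  simp only [mul_sub, Finset.sum_sub_distrib, ← Finset.sum_mul, hp, one_mul, sub_self]

variable [DecidableEq S]

lemma sum_count_mul {n : ℕ} (s : Fin n → S) (g : S → ℝ) :
    ∑ j, (#{k : Fin n | s k = j} : ℝ) * g j = ∑ k, g (s k) := by
  rw [← Finset.sum_fiberwise_of_maps_to (s := Finset.univ) (t := Finset.univ) (g := s)
    (fun _ _ => Finset.mem_univ _)]
  refine Finset.sum_congr rfl fun j _ => ?_
  rw [Finset.sum_congr rfl (g := fun _ => g j) fun k hk => by rw [(Finset.mem_filter.1 hk).2]]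
  simp

/-- The law is a finite combination of point masses, so no condition on `f` is needed. -/
lemma integrable_multinomialLaw (n : ℕ) (p : S → ℝ) (f : (S → ℕ) → ℝ) :
    Integrable f (multinomialLaw n p) := by
  unfold multinomialLaw
  rw [integrable_finsetSum_measure]
  exact fun s _ => (integrable_dirac (by simp)).smul_measure ENNReal.ofReal_ne_top

lemma integral_multinomialLaw (n : ℕ) {p : S → ℝ} (hp : ∀ j, 0 ≤ p j) (f : (S → ℕ) → ℝ) :
    ∫ c, f c ∂(multinomialLaw n p) =
      ∑ s : Fin n → S, (∏ k, p (s k)) * f fun j => #{k : Fin n | s k = j} := by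
  unfold multinomialLaw
  rw [integral_finsetSum_measure fun s _ =>
    (integrable_dirac (by simp)).smul_measure ENNReal.ofReal_ne_top]
  refine Finset.sum_congr rfl fun s _ => ?_
  rw [integral_smul_measure, integral_dirac,
    ENNReal.toReal_ofReal (Finset.prod_nonneg fun _ _ => hp _), smul_eq_mul]

lemma ae_sum_eq_multinomialLaw (n : ℕ) (p : S → ℝ) :
    ∀ᵐ c ∂(multinomialLaw n p), ∑ j, c j = n := by
  unfold multinomialLaw
  rw [ae_finsetSum_measure_iff]
  intro s _
  refine Measure.ae_smul_measure ?_ _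
  rw [ae_dirac_eq, Filter.eventually_pure]
  rw [← Finset.card_eq_sum_card_fiberwise (fun _ _ => Finset.mem_univ _)]
  simp

lemma sum_sub_count_mul {n : ℕ} (hn : 0 < n) (p g : S → ℝ) (s : Fin n → S) :
    ∑ j, (p j - (#{k : Fin n | s k = j} : ℝ) / n) * g j =
      -(1 / (n : ℝ)) * ∑ k, (g (s k) - ∑ j, p j * g j) := by
  have hn' : (n : ℝ) ≠ 0 := by positivity
  simp only [sub_mul, Finset.sum_sub_distrib, div_mul_eq_mul_div, ← Finset.sum_div,
    sum_count_mul]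
  simp only [Finset.sum_const, Finset.card_univ, Fintype.card_fin, nsmul_eq_mul]
  field_simp
  ring

/-- The first moment of a centred linear functional of the empirical frequencies. -/
lemma integral_multinomialLaw_linear {n : ℕ} (hn : 0 < n) {p : S → ℝ} (hp0 : ∀ j, 0 ≤ p j)
    (hp : ∑ j, p j = 1) (g : S → ℝ) :
    ∫ c, (∑ j, (p j - (c j : ℝ) / n) * g j) ∂(multinomialLaw n p) = 0 := by
  rw [integral_multinomialLaw n hp0]
  simp only [sum_sub_count_mul hn, mul_left_comm _ (-(1 / (n : ℝ)))]
  rw [← Finset.mul_sum, sum_draws_linear hp (sum_mul_sub_mean hp g) n, mul_zero]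

/-- The second moment of a centred linear functional of the empirical frequencies. -/
lemma integral_multinomialLaw_sq {n : ℕ} (hn : 0 < n) {p : S → ℝ} (hp0 : ∀ j, 0 ≤ p j)
    (hp : ∑ j, p j = 1) (g : S → ℝ) :
    ∫ c, (∑ j, (p j - (c j : ℝ) / n) * g j) ^ 2 ∂(multinomialLaw n p) =
      (∑ j, p j * (g j - ∑ j, p j * g j) ^ 2) / n := by
  have hn' : (n : ℝ) ≠ 0 := by positivity
  rw [integral_multinomialLaw n hp0]
  simp only [sum_sub_count_mul hn, mul_pow, mul_left_comm _ ((-(1 / (n : ℝ))) ^ 2)]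
  rw [← Finset.mul_sum, sum_draws_sq hp (sum_mul_sub_mean hp g) n]
  field_simp

end Multinomial

/-! ### Moments and measurability of the empirical estimates. -/

section Sampling

variable {S : Type*} [Fintype S] [DecidableEq S] {Ω : Type*} [MeasurableSpace Ω] {n : ℕ}
  {D : SampleData S Ω n} {μ : Measure Ω} {P : Matrix S S ℝ} {ν : S → Measure ℝ}

lemma SampleData.Assumption.integrable_counts (h : D.Assumption μ P ν) (i : S)
    (f : (S → ℕ) → ℝ) : Integrable (fun ω => f (D.counts i ω)) μ := by
  have hl := h.counts_law i
  have := integrable_multinomialLaw n (P i) f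
  rw [← hl.map_eq] at this
  exact this.comp_aemeasurable hl.aemeasurable

lemma SampleData.Assumption.integral_counts (h : D.Assumption μ P ν) (i : S)
    (f : (S → ℕ) → ℝ) : ∫ ω, f (D.counts i ω) ∂μ = ∫ c, f c ∂(multinomialLaw n (P i)) :=
  (h.counts_law i).integral_comp (Measurable.of_discrete (f := f)).aestronglyMeasurable

/-- This lets every deterministic bound for stochastic matrices be applied to `P̂` almost surely. -/
lemma SampleData.Assumption.ae_mem_rowStochastic (h : D.Assumption μ P ν) (hn : 0 < n) :
    ∀ᵐ ω ∂μ, D.Phat ω ∈ rowStochastic ℝ S := by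
  have h1 : ∀ᵐ ω ∂μ, ∀ i, ∑ j, D.counts i ω j = n := by
    rw [ae_all_iff]
    intro i
    have h2 := ae_sum_eq_multinomialLaw n (P i)
    rw [← (h.counts_law i).map_eq] at h2
    exact ae_of_ae_map (h.counts_law i).aemeasurable h2
  filter_upwards [h1] with ω hω
  rw [mem_rowStochastic_iff_sum]
  refine ⟨fun i j => by simp only [Phat, of_apply]; positivity, fun i => ?_⟩
  have hn' : (n : ℝ) ≠ 0 := by positivity
  simp only [Phat, of_apply, ← Finset.sum_div]
  rw [← Nat.cast_sum, hω i, div_self hn']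

lemma SampleData.Assumption.aemeasurable_bhat (h : D.Assumption μ P ν) :
    AEMeasurable D.bhat μ := by
  unfold bhat
  refine aemeasurable_pi_lambda _ fun i => ?_
  exact (Finset.aemeasurable_fun_sum _ fun k _ => (h.reward_law i k).aemeasurable).div_const _

lemma SampleData.Assumption.aemeasurable_counts (h : D.Assumption μ P ν) :
    AEMeasurable (fun ω i => D.counts i ω) μ :=
  aemeasurable_pi_lambda _ fun i => (h.counts_law i).aemeasurable

/-- A function of the estimates is measurable when it is measurable in the reward estimate. -/
lemma SampleData.Assumption.aemeasurable_estimates (h : D.Assumption μ P ν)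
    (F : Matrix S S ℝ → (S → ℝ) → ℝ) (hF : ∀ Q, Measurable (F Q)) :
    AEMeasurable (fun ω => F (D.Phat ω) (D.bhat ω)) μ := by
  -- Count tables form a countable discrete space, so joint measurability reduces to fixed tables,
  -- and the dependence on the matrix (including its inverse) is irrelevant.
  have hm : ∀ T : (S → S → ℕ) → Matrix S S ℝ,
      Measurable fun x : (S → S → ℕ) × (S → ℝ) => F (T x.1) x.2 :=
    fun T => measurable_from_prod_countable_right fun c => hF (T c)
  have h1 := (hm fun c => Matrix.of fun i j => (c i j : ℝ) / n).comp_aemeasurable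
    (h.aemeasurable_counts.prodMk h.aemeasurable_bhat)
  exact h1.congr (Eventually.of_forall fun ω => rfl)

/-- The moments of a row of `(P - P̂) g`. -/
lemma SampleData.Assumption.integral_row (h : D.Assumption μ P ν) (hn : 0 < n)
    (hP : P ∈ rowStochastic ℝ S) (i : S) (g : S → ℝ) :
    ∫ ω, ((P - D.Phat ω) *ᵥ g) i ∂μ = 0 ∧
    ∫ ω, ((P - D.Phat ω) *ᵥ g) i ^ 2 ∂μ =
      (∑ j, P i j * (g j - ∑ j, P i j * g j) ^ 2) / n :=
  ⟨(h.integral_counts i _).trans (integral_multinomialLaw_linear hn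
      (fun _ => nonneg_of_mem_rowStochastic hP) (sum_row_of_mem_rowStochastic hP i) g),
    (h.integral_counts i fun c => (∑ j, (P i j - (c j : ℝ) / n) * g j) ^ 2).trans
      (integral_multinomialLaw_sq hn
      (fun _ => nonneg_of_mem_rowStochastic hP) (sum_row_of_mem_rowStochastic hP i) g)⟩

lemma SampleData.Assumption.memLp_row (h : D.Assumption μ P ν) (i : S) (g : S → ℝ) :
    MemLp (fun ω => ((P - D.Phat ω) *ᵥ g) i) 2 μ := by
  have h1 : Integrable (fun ω => ((P - D.Phat ω) *ᵥ g) i) μ :=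
    h.integrable_counts i fun c => ∑ j, (P i j - (c j : ℝ) / n) * g j
  rw [memLp_two_iff_integrable_sq h1.1]
  exact h.integrable_counts i fun c => (∑ j, (P i j - (c j : ℝ) / n) * g j) ^ 2

lemma SampleData.Assumption.memLp_reward (h : D.Assumption μ P ν) (hν : ∀ i, MemLp id 2 (ν i))
    (i : S) (k : Fin n) : MemLp (D.reward i k) 2 μ := by
  have h1 := hν i
  rw [← (h.reward_law i k).map_eq] at h1
  exact h1.comp_of_map (h.reward_law i k).aemeasurable

lemma SampleData.Assumption.memLp_bhat (h : D.Assumption μ P ν) (hν : ∀ i, MemLp id 2 (ν i))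
    (i : S) : MemLp (fun ω => D.bhat ω i) 2 μ := by
  have := (memLp_finsetSum Finset.univ fun k _ => h.memLp_reward hν i k).mul_const (n : ℝ)⁻¹
  simpa [SampleData.bhat, div_eq_mul_inv] using this

lemma SampleData.Assumption.integral_bhat [IsProbabilityMeasure μ] (h : D.Assumption μ P ν)
    (hn : 0 < n) (hν : ∀ i, MemLp id 2 (ν i)) (i : S) :
    ∫ ω, D.bhat ω i ∂μ = ∫ x, x ∂(ν i) := by
  have hn' : (n : ℝ) ≠ 0 := by positivity
  simp only [SampleData.bhat]
  rw [integral_div, integral_finsetSum _ fun k _ =>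
    (h.memLp_reward hν i k).integrable one_le_two]
  simp only [(h.reward_law i _).integral_eq]
  simp [hn']

lemma SampleData.Assumption.variance_bhat [IsProbabilityMeasure μ] (h : D.Assumption μ P ν)
    (hn : 0 < n) (hν : ∀ i, MemLp id 2 (ν i)) (i : S) :
    Var[fun ω => D.bhat ω i; μ] = Var[id; ν i] / n := by
  have hn' : (n : ℝ) ≠ 0 := by positivity
  have h1 : Var[∑ k, D.reward i k; μ] = n * Var[id; ν i] := by
    rw [IndepFun.variance_sum (fun k _ => h.memLp_reward hν i k)
      fun k _ l _ hkl => (h.reward_indep i).indepFun hkl]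
    simp [(h.reward_law i _).variance_eq]
  have h2 : (fun ω => D.bhat ω i) = fun ω => (n : ℝ)⁻¹ * (∑ k, D.reward i k) ω := by
    ext ω
    simp [SampleData.bhat, div_eq_inv_mul]
  rw [h2, variance_const_mul, h1]
  field_simp

lemma SampleData.Assumption.integral_bhat_mul_row [IsProbabilityMeasure μ]
    (h : D.Assumption μ P ν) (hn : 0 < n) (hν : ∀ i, MemLp id 2 (ν i))
    (hP : P ∈ rowStochastic ℝ S) (i : S) (g : S → ℝ) :
    ∫ ω, (D.bhat ω i - ∫ x, x ∂(ν i)) * ((P - D.Phat ω) *ᵥ g) i ∂μ = 0 := by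
  have hind := h.indep.symm.comp (φ := fun x => x i - ∫ x, x ∂(ν i))
    (ψ := fun c : S → S → ℕ => ((P - Matrix.of fun i j => (c i j : ℝ) / n) *ᵥ g) i)
    (by fun_prop) Measurable.of_discrete
  have h1 := hind.integral_fun_mul_eq_mul_integral
    ((h.memLp_bhat hν i).1.sub aestronglyMeasurable_const) (h.memLp_row i g).1
  refine h1.trans ?_
  have h2 := (h.integral_row hn hP i g).1
  refine mul_eq_zero_of_right _ h2

end Sampling

/-! ### Exact perturbation identities for the inverse of `I - γ Q`. -/

section Perturbation

open scoped Matrix.Norms.Operator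

variable {S : Type*} [Fintype S] [DecidableEq S] {γ : ℝ} {P Q M : Matrix S S ℝ} {b : S → ℝ}

/-- The relative perturbation `γ (P - Q) A⁻¹` of `A = I - γ P`. -/
noncomputable def relPert (γ : ℝ) (P Q : Matrix S S ℝ) : Matrix S S ℝ :=
  (γ • (P - Q)) * (opA γ P)⁻¹

/-- The matrix `A (I - γ Q)⁻¹`, inverse to `1 + relPert γ P Q`. -/
noncomputable def pertInv (γ : ℝ) (P Q : Matrix S S ℝ) : Matrix S S ℝ :=
  opA γ P * (opA γ Q)⁻¹

/-- The first-order error `x - b - Y b` of the estimate `A (I - γ Q)⁻¹ x` of `b`. -/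
noncomputable def linErr (γ : ℝ) (P : Matrix S S ℝ) (b : S → ℝ) (Q : Matrix S S ℝ) (x : S → ℝ) :
    S → ℝ :=
  x - b - relPert γ P Q *ᵥ b

/-- The error `A (I - γ Q)⁻¹ x - b` in the image of `A`, expressed by the first-order error. -/
noncomputable def fullErr (γ : ℝ) (P : Matrix S S ℝ) (b : S → ℝ) (Q : Matrix S S ℝ) (x : S → ℝ) :
    S → ℝ :=
  pertInv γ P Q *ᵥ linErr γ P b Q x

lemma relPert_mulVec_apply (γ : ℝ) (P Q : Matrix S S ℝ) (g : S → ℝ) (i : S) :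
    (relPert γ P Q *ᵥ g) i = γ * ((P - Q) *ᵥ ((opA γ P)⁻¹ *ᵥ g)) i := by
  rw [relPert, ← mulVec_mulVec, smul_mulVec, Pi.smul_apply, smul_eq_mul]

lemma opA_eq_mul (hγ : γ ∈ Set.Ioo (0 : ℝ) 1) (hP : P ∈ rowStochastic ℝ S) (Q : Matrix S S ℝ) :
    opA γ Q = (1 + relPert γ P Q) * opA γ P := by
  rw [add_mul, one_mul, relPert, mul_assoc, nonsing_inv_mul _ (isUnit_det_opA hγ hP), mul_one]
  simp only [opA, smul_sub]
  abel

lemma one_add_relPert_mul_pertInv (hγ : γ ∈ Set.Ioo (0 : ℝ) 1) (hP : P ∈ rowStochastic ℝ S)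
    (hQ : Q ∈ rowStochastic ℝ S) : (1 + relPert γ P Q) * pertInv γ P Q = 1 := by
  rw [pertInv, ← mul_assoc, ← opA_eq_mul hγ hP, mul_nonsing_inv _ (isUnit_det_opA hγ hQ)]

lemma pertInv_mul_one_add_relPert (hγ : γ ∈ Set.Ioo (0 : ℝ) 1) (hP : P ∈ rowStochastic ℝ S)
    (hQ : Q ∈ rowStochastic ℝ S) : pertInv γ P Q * (1 + relPert γ P Q) = 1 :=
  mul_eq_one_comm.1 (one_add_relPert_mul_pertInv hγ hP hQ)

lemma norm_relPert_le (hγ : γ ∈ Set.Ioo (0 : ℝ) 1) (hP : P ∈ rowStochastic ℝ S)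
    (hQ : Q ∈ rowStochastic ℝ S) : ‖relPert γ P Q‖ ≤ 2 * (1 - γ)⁻¹ := by
  refine (norm_mul_le _ _).trans (mul_le_mul ?_ (norm_inv_opA_le hγ hP) (norm_nonneg _) two_pos.le)
  rw [smul_sub]
  have h1 := norm_smul_rowStochastic_le hγ hP
  have h2 := norm_smul_rowStochastic_le hγ hQ
  have h3 := norm_sub_le (γ • P) (γ • Q)
  have h4 := hγ.2
  linarith

/-- The bound is uniform over all stochastic `Q`, however far from `P`; this makes the moments
finite for every positive `n`, not only for large `n`. -/
lemma norm_pertInv_le (hγ : γ ∈ Set.Ioo (0 : ℝ) 1) (hP : P ∈ rowStochastic ℝ S)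
    (hQ : Q ∈ rowStochastic ℝ S) : ‖pertInv γ P Q‖ ≤ 2 * (1 - γ)⁻¹ :=
  (norm_mul_le _ _).trans
    (mul_le_mul (norm_opA_le hγ hP) (norm_inv_opA_le hγ hQ) (norm_nonneg _) two_pos.le)

lemma norm_fullErr_le (hγ : γ ∈ Set.Ioo (0 : ℝ) 1) (hP : P ∈ rowStochastic ℝ S)
    (hQ : Q ∈ rowStochastic ℝ S) (x : S → ℝ) :
    ‖fullErr γ P b Q x‖ ≤ 2 * (1 - γ)⁻¹ * ‖linErr γ P b Q x‖ :=
  (linfty_opNorm_mulVec _ _).trans (by gcongr; exact norm_pertInv_le hγ hP hQ)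

/-- The converse comparison `u = (1 + Y) e`, from which the lower bound on `MSE(1)` comes. -/
lemma norm_linErr_le (hγ : γ ∈ Set.Ioo (0 : ℝ) 1) (hP : P ∈ rowStochastic ℝ S)
    (hQ : Q ∈ rowStochastic ℝ S) (x : S → ℝ) :
    ‖linErr γ P b Q x‖ ≤ (1 + 2 * (1 - γ)⁻¹) * ‖fullErr γ P b Q x‖ := by
  have h : linErr γ P b Q x = (1 + relPert γ P Q) *ᵥ fullErr γ P b Q x := by
    rw [fullErr, mulVec_mulVec, one_add_relPert_mul_pertInv hγ hP hQ, one_mulVec]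
  rw [h]
  refine (linfty_opNorm_mulVec _ _).trans ?_
  gcongr
  exact (norm_add_le _ _).trans (add_le_add matrix_norm_one_le (norm_relPert_le hγ hP hQ))

lemma pertInv_mulVec_eq (hγ : γ ∈ Set.Ioo (0 : ℝ) 1) (hP : P ∈ rowStochastic ℝ S)
    (hQ : Q ∈ rowStochastic ℝ S) (x : S → ℝ) :
    pertInv γ P Q *ᵥ x = b + fullErr γ P b Q x := by
  have h : linErr γ P b Q x = x - (1 + relPert γ P Q) *ᵥ b := by
    rw [linErr, add_mulVec, one_mulVec, sub_sub]
  rw [fullErr, h, mulVec_sub, mulVec_mulVec, pertInv_mul_one_add_relPert hγ hP hQ, one_mulVec,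
    add_sub_cancel]

/-- From `(1 + Y)⁻¹ = 1 - (1 + Y)⁻¹ Y`: the linear part is isolated with an exact remainder of
second order in `(Y, u)`. -/
lemma fullErr_eq (hγ : γ ∈ Set.Ioo (0 : ℝ) 1) (hP : P ∈ rowStochastic ℝ S)
    (hQ : Q ∈ rowStochastic ℝ S) (x : S → ℝ) :
    fullErr γ P b Q x = linErr γ P b Q x -
      pertInv γ P Q *ᵥ (relPert γ P Q *ᵥ linErr γ P b Q x) := by
  have h := pertInv_mul_one_add_relPert hγ hP hQ
  rw [mul_add, mul_one] at h
  rw [fullErr, mulVec_mulVec, eq_sub_iff_add_eq, ← add_mulVec, h, one_mulVec]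

lemma normSq_eq (γ : ℝ) (P M : Matrix S S ℝ) (x : S → ℝ) :
    normSq γ P M x = (opA γ P *ᵥ x) ⬝ᵥ (M *ᵥ (opA γ P *ᵥ x)) := by
  rw [normSq, ← mulVec_mulVec, ← mulVec_mulVec, dotProduct_mulVec, vecMul_transpose]

lemma normSq_value_sub (hγ : γ ∈ Set.Ioo (0 : ℝ) 1) (hP : P ∈ rowStochastic ℝ S)
    (hQ : Q ∈ rowStochastic ℝ S) (hM : M.PosDef) (x : S → ℝ) (ε : ℝ) :
    normSq γ P M (value γ P b - ε • value γ Q x) =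
      fullErr γ P b Q x ⬝ᵥ (M *ᵥ fullErr γ P b Q x)
      - 2 * (1 - ε) * (fullErr γ P b Q x ⬝ᵥ (M *ᵥ (b + fullErr γ P b Q x)))
      + (1 - ε) ^ 2 * ((b + fullErr γ P b Q x) ⬝ᵥ (M *ᵥ (b + fullErr γ P b Q x))) := by
  have h : opA γ P *ᵥ (value γ P b - ε • value γ Q x) =
      (1 - ε) • (b + fullErr γ P b Q x) - fullErr γ P b Q x := by
    rw [mulVec_sub, mulVec_smul, value, value, mulVec_mulVec, mulVec_mulVec,
      mul_nonsing_inv _ (isUnit_det_opA hγ hP), one_mulVec]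
    rw [show opA γ P * (opA γ Q)⁻¹ = pertInv γ P Q from rfl, pertInv_mulVec_eq (b := b) hγ hP hQ]
    module
  rw [normSq_eq, h]
  generalize fullErr γ P b Q x = e
  have hs := dotProduct_mulVec_symm hM (b + e) e
  simp only [mulVec_sub, mulVec_smul, sub_dotProduct, dotProduct_sub, smul_dotProduct,
    dotProduct_smul, smul_eq_mul, hs]
  ring

end Perturbation

/-! ### Second moments of the first-order error and of `Ŷ`, and the covariance of `b̂`. -/

section Moments

open scoped Matrix.Norms.Operator

variable {S : Type*} [Fintype S] [DecidableEq S] {Ω : Type*} [MeasurableSpace Ω] {n : ℕ}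
  {D : SampleData S Ω n} {μ : Measure Ω} {γ : ℝ} {P M : Matrix S S ℝ} {b : S → ℝ}
  {ν : S → Measure ℝ}

/-- The variance of `g` under the `i`-th row of `P`. -/
noncomputable def rowVar (P : Matrix S S ℝ) (g : S → ℝ) (i : S) : ℝ :=
  ∑ j, P i j * (g j - ∑ j, P i j * g j) ^ 2

lemma rowVar_nonneg (hP : P ∈ rowStochastic ℝ S) (g : S → ℝ) (i : S) : 0 ≤ rowVar P g i :=
  Finset.sum_nonneg fun _ _ => mul_nonneg (nonneg_of_mem_rowStochastic hP) (sq_nonneg _)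

/-- The total variance per sample of the first-order error. -/
noncomputable def errVar (γ : ℝ) (P : Matrix S S ℝ) (b : S → ℝ) (ν : S → Measure ℝ) : ℝ :=
  ∑ i, (Var[id; ν i] + γ ^ 2 * rowVar P ((opA γ P)⁻¹ *ᵥ b) i)

lemma errVar_nonneg (hP : P ∈ rowStochastic ℝ S) (γ : ℝ) (b : S → ℝ) (ν : S → Measure ℝ) :
    0 ≤ errVar γ P b ν :=
  Finset.sum_nonneg fun i _ => add_nonneg (variance_nonneg _ _)
    (mul_nonneg (sq_nonneg _) (rowVar_nonneg hP _ i))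

/-- The total second moment per sample of the entries of `Ŷ`. -/
noncomputable def pertVar (γ : ℝ) (P : Matrix S S ℝ) : ℝ :=
  ∑ i, ∑ j, γ ^ 2 * rowVar P ((opA γ P)⁻¹ *ᵥ Pi.single j 1) i

lemma SampleData.Assumption.memLp_relPert_mulVec (h : D.Assumption μ P ν) (g : S → ℝ) (i : S) :
    MemLp (fun ω => (relPert γ P (D.Phat ω) *ᵥ g) i) 2 μ := by
  simp only [relPert_mulVec_apply]
  exact (h.memLp_row i _).const_mul γ

lemma SampleData.Assumption.integral_relPert_mulVec_sq (h : D.Assumption μ P ν) (hn : 0 < n)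
    (hP : P ∈ rowStochastic ℝ S) (g : S → ℝ) (i : S) :
    ∫ ω, (relPert γ P (D.Phat ω) *ᵥ g) i ^ 2 ∂μ =
      γ ^ 2 * rowVar P ((opA γ P)⁻¹ *ᵥ g) i / n := by
  simp only [relPert_mulVec_apply, mul_pow]
  rw [integral_const_mul, (h.integral_row hn hP i _).2, rowVar, mul_div_assoc]

lemma SampleData.Assumption.memLp_linErr [IsProbabilityMeasure μ] (h : D.Assumption μ P ν)
    (hν : ∀ i, MemLp id 2 (ν i)) (i : S) :
    MemLp (fun ω => linErr γ P b (D.Phat ω) (D.bhat ω) i) 2 μ :=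
  ((h.memLp_bhat hν i).sub (memLp_const (b i))).sub (h.memLp_relPert_mulVec b i)

lemma SampleData.Assumption.integral_linErr [IsProbabilityMeasure μ] (h : D.Assumption μ P ν)
    (hn : 0 < n) (hP : P ∈ rowStochastic ℝ S) (hν : ∀ i, MemLp id 2 (ν i))
    (hb : ∀ i, b i = ∫ x, x ∂(ν i)) (i : S) :
    ∫ ω, linErr γ P b (D.Phat ω) (D.bhat ω) i ∂μ = 0 := by
  have h1 := (h.memLp_bhat hν i).integrable one_le_two
  have h2 := (h.memLp_relPert_mulVec (γ := γ) b i).integrable one_le_two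
  simp only [linErr, Pi.sub_apply]
  have h3 : Integrable (fun ω => D.bhat ω i - b i) μ := h1.sub (integrable_const _)
  rw [integral_sub h3 h2, integral_sub h1 (integrable_const _),
    h.integral_bhat hn hν, ← hb]
  simp only [relPert_mulVec_apply]
  rw [integral_const_mul, (h.integral_row hn hP i _).1]
  simp

lemma SampleData.Assumption.integral_linErr_sq [IsProbabilityMeasure μ] (h : D.Assumption μ P ν)
    (hn : 0 < n) (hP : P ∈ rowStochastic ℝ S) (hν : ∀ i, MemLp id 2 (ν i))
    (hb : ∀ i, b i = ∫ x, x ∂(ν i)) (i : S) :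
    ∫ ω, linErr γ P b (D.Phat ω) (D.bhat ω) i ^ 2 ∂μ =
      (Var[id; ν i] + γ ^ 2 * rowVar P ((opA γ P)⁻¹ *ᵥ b) i) / n := by
  have h1 : MemLp (fun ω => D.bhat ω i - b i) 2 μ := (h.memLp_bhat hν i).sub (memLp_const _)
  have h2 := h.memLp_relPert_mulVec (γ := γ) b i
  -- Independence of `P̂` and `b̂` removes the cross term, so the two variances add.
  have h3 : ∫ ω, (D.bhat ω i - b i) * (relPert γ P (D.Phat ω) *ᵥ b) i ∂μ = 0 := by
    have := h.integral_bhat_mul_row hn hν hP i ((opA γ P)⁻¹ *ᵥ b)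
    simp only [relPert_mulVec_apply, mul_left_comm _ γ, hb i]
    rw [integral_const_mul, this, mul_zero]
  have h4 : ∫ ω, (D.bhat ω i - b i) ^ 2 ∂μ = Var[id; ν i] / n := by
    rw [← h.variance_bhat hn hν i, variance_eq_integral (h.memLp_bhat hν i).1.aemeasurable,
      h.integral_bhat hn hν, hb i]
  have h5 : ∀ ω, linErr γ P b (D.Phat ω) (D.bhat ω) i ^ 2 =
      (D.bhat ω i - b i) ^ 2 - 2 * ((D.bhat ω i - b i) * (relPert γ P (D.Phat ω) *ᵥ b) i) +
        (relPert γ P (D.Phat ω) *ᵥ b) i ^ 2 := fun ω => by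
    simp only [linErr, Pi.sub_apply]
    ring
  simp only [h5]
  have h6 : Integrable
      (fun ω => 2 * ((D.bhat ω i - b i) * (relPert γ P (D.Phat ω) *ᵥ b) i)) μ :=
    (h1.integrable_mul h2).const_mul 2
  have h7 : Integrable (fun ω => (D.bhat ω i - b i) ^ 2 -
      2 * ((D.bhat ω i - b i) * (relPert γ P (D.Phat ω) *ᵥ b) i)) μ := h1.integrable_sq.sub h6
  rw [integral_add h7 h2.integrable_sq, integral_sub h1.integrable_sq h6,
    integral_const_mul, h3, h4, h.integral_relPert_mulVec_sq hn hP]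
  ring

lemma SampleData.Assumption.integral_sum_linErr_sq [IsProbabilityMeasure μ]
    (h : D.Assumption μ P ν) (hn : 0 < n) (hP : P ∈ rowStochastic ℝ S)
    (hν : ∀ i, MemLp id 2 (ν i)) (hb : ∀ i, b i = ∫ x, x ∂(ν i)) :
    ∫ ω, ∑ i, linErr γ P b (D.Phat ω) (D.bhat ω) i ^ 2 ∂μ = errVar γ P b ν / n := by
  rw [integral_finsetSum _ fun i _ => (h.memLp_linErr hν i).integrable_sq]
  simp only [h.integral_linErr_sq hn hP hν hb]
  rw [← Finset.sum_div, errVar]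

lemma measurable_linErr_apply (γ : ℝ) (P : Matrix S S ℝ) (b : S → ℝ) (Q : Matrix S S ℝ) (i : S) :
    Measurable fun x => linErr γ P b Q x i := by
  unfold linErr
  simp only [Pi.sub_apply]
  fun_prop

lemma measurable_linErr (γ : ℝ) (P : Matrix S S ℝ) (b : S → ℝ) (Q : Matrix S S ℝ) :
    Measurable fun x => linErr γ P b Q x :=
  measurable_pi_lambda _ fun i => measurable_linErr_apply γ P b Q i

lemma measurable_fullErr (γ : ℝ) (P : Matrix S S ℝ) (b : S → ℝ) (Q : Matrix S S ℝ) :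
    Measurable fun x => fullErr γ P b Q x := by
  refine measurable_pi_lambda _ fun i => ?_
  have := fun j => measurable_linErr_apply γ P b Q j
  unfold fullErr mulVec dotProduct
  fun_prop

lemma SampleData.Assumption.integrable_norm_linErr_sq [IsProbabilityMeasure μ]
    (h : D.Assumption μ P ν) (hν : ∀ i, MemLp id 2 (ν i)) :
    Integrable (fun ω => ‖linErr γ P b (D.Phat ω) (D.bhat ω)‖ ^ 2) μ := by
  refine (integrable_finsetSum Finset.univ fun i _ =>
    (h.memLp_linErr (γ := γ) (b := b) hν i).integrable_sq).mono' ?_ (Eventually.of_forall ?_)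
  · exact (h.aemeasurable_estimates (fun Q x => ‖linErr γ P b Q x‖ ^ 2)
      fun Q => (measurable_linErr γ P b Q).norm.pow_const 2).aestronglyMeasurable
  · intro ω
    rw [Real.norm_of_nonneg (by positivity)]
    exact vec_norm_sq_le _

lemma SampleData.Assumption.integral_norm_linErr_sq_le [IsProbabilityMeasure μ]
    (h : D.Assumption μ P ν) (hn : 0 < n) (hP : P ∈ rowStochastic ℝ S)
    (hν : ∀ i, MemLp id 2 (ν i)) (hb : ∀ i, b i = ∫ x, x ∂(ν i)) :
    ∫ ω, ‖linErr γ P b (D.Phat ω) (D.bhat ω)‖ ^ 2 ∂μ ≤ errVar γ P b ν / n := by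
  rw [← h.integral_sum_linErr_sq hn hP hν hb]
  exact integral_mono (h.integrable_norm_linErr_sq hν)
    (integrable_finsetSum _ fun i _ => (h.memLp_linErr hν i).integrable_sq)
    fun ω => vec_norm_sq_le _

lemma SampleData.Assumption.le_integral_norm_linErr_sq [IsProbabilityMeasure μ]
    (h : D.Assumption μ P ν) (hn : 0 < n) (hP : P ∈ rowStochastic ℝ S)
    (hν : ∀ i, MemLp id 2 (ν i)) (hb : ∀ i, b i = ∫ x, x ∂(ν i)) :
    errVar γ P b ν / n ≤
      Fintype.card S * ∫ ω, ‖linErr γ P b (D.Phat ω) (D.bhat ω)‖ ^ 2 ∂μ := by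
  rw [← h.integral_sum_linErr_sq hn hP hν hb, ← integral_const_mul]
  exact integral_mono (integrable_finsetSum _ fun i _ => (h.memLp_linErr hν i).integrable_sq)
    ((h.integrable_norm_linErr_sq hν).const_mul _) fun ω => sum_sq_le_vec_norm_sq _

/-- A quantity bounded by the squared first-order error is integrable. -/
lemma SampleData.Assumption.integrable_of_abs_le [IsProbabilityMeasure μ]
    (h : D.Assumption μ P ν) (hn : 0 < n) (hν : ∀ i, MemLp id 2 (ν i))
    (F : Matrix S S ℝ → (S → ℝ) → ℝ) (hF : ∀ Q, Measurable (F Q)) (C : ℝ)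
    (hC : ∀ Q ∈ rowStochastic ℝ S, ∀ x, |F Q x| ≤ C * (1 + ‖linErr γ P b Q x‖ ^ 2)) :
    Integrable (fun ω => F (D.Phat ω) (D.bhat ω)) μ := by
  refine (((integrable_const 1).add
    (h.integrable_norm_linErr_sq (γ := γ) (b := b) hν)).const_mul C).mono'
    (h.aemeasurable_estimates F hF).aestronglyMeasurable ?_
  filter_upwards [h.ae_mem_rowStochastic hn] with ω hω
  exact hC _ hω _

lemma SampleData.Assumption.integrable_norm_relPert_sq [IsProbabilityMeasure μ]
    (h : D.Assumption μ P ν) (hγ : γ ∈ Set.Ioo (0 : ℝ) 1) (hP : P ∈ rowStochastic ℝ S)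
    (hn : 0 < n) :
    Integrable (fun ω => ‖relPert γ P (D.Phat ω)‖ ^ 2) μ := by
  refine (integrable_const ((2 * (1 - γ)⁻¹) ^ 2)).mono'
    (h.aemeasurable_estimates (fun Q _ => ‖relPert γ P Q‖ ^ 2)
      fun Q => measurable_const).aestronglyMeasurable ?_
  filter_upwards [h.ae_mem_rowStochastic hn] with ω hω
  rw [Real.norm_of_nonneg (by positivity)]
  have := norm_relPert_le hγ hP hω
  gcongr

lemma SampleData.Assumption.integral_norm_relPert_sq_le [IsProbabilityMeasure μ]
    (h : D.Assumption μ P ν) (hγ : γ ∈ Set.Ioo (0 : ℝ) 1) (hP : P ∈ rowStochastic ℝ S)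
    (hn : 0 < n) :
    ∫ ω, ‖relPert γ P (D.Phat ω)‖ ^ 2 ∂μ ≤ (Fintype.card S : ℝ) ^ 2 * pertVar γ P / n := by
  -- Entries are read off on basis vectors, so the moment formula for `Y g` applies to them.
  have h1 : ∀ ω i j, relPert γ P (D.Phat ω) i j =
      (relPert γ P (D.Phat ω) *ᵥ Pi.single j 1) i := fun ω i j => by simp
  have hint : ∀ i j, Integrable (fun ω => relPert γ P (D.Phat ω) i j ^ 2) μ := fun i j => by
    simp only [h1]
    exact (h.memLp_relPert_mulVec _ i).integrable_sq
  have h2 : ∫ ω, ∑ i, ∑ j, relPert γ P (D.Phat ω) i j ^ 2 ∂μ = pertVar γ P / n := by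
    rw [integral_finsetSum _ fun i _ => integrable_finsetSum _ fun j _ => hint i j]
    simp_rw [integral_finsetSum _ fun j _ => hint _ j, h1, h.integral_relPert_mulVec_sq hn hP,
      ← Finset.sum_div]
    rfl
  rw [mul_div_assoc, ← h2, ← integral_const_mul]
  exact integral_mono (h.integrable_norm_relPert_sq hγ hP hn)
    ((integrable_finsetSum _ fun i _ => integrable_finsetSum _ fun j _ => hint i j).const_mul _)
    fun ω => matrix_norm_sq_le _

/-- Rewards at different states may be correlated. Nonnegativity of the variances of `X ± Z`
controls the off-diagonal covariances by the diagonal ones. -/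
lemma abs_covariance_le {X Z : Ω → ℝ} [IsProbabilityMeasure μ] (hX : MemLp X 2 μ)
    (hZ : MemLp Z 2 μ) : |cov[X, Z; μ]| ≤ Var[X; μ] + Var[Z; μ] := by
  have h1 := variance_add hX hZ
  have h2 := variance_sub hX hZ
  have h3 := variance_nonneg (X + Z) μ
  have h4 := variance_nonneg (X - Z) μ
  have h5 := variance_nonneg X μ
  have h6 := variance_nonneg Z μ
  rw [abs_le]
  constructor <;> linarith

lemma SampleData.Assumption.abs_covBhat_le [IsProbabilityMeasure μ]
    (h : D.Assumption μ P ν) (hn : 0 < n) (hν : ∀ i, MemLp id 2 (ν i)) (i j : S) :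
    |covBhat μ D i j| ≤ (Var[id; ν i] + Var[id; ν j]) / n := by
  rw [add_div, ← h.variance_bhat hn hν i, ← h.variance_bhat hn hν j]
  exact abs_covariance_le (h.memLp_bhat hν i) (h.memLp_bhat hν j)

end Moments

/-! ### Mean square error: expansion in `1 - ε`, upper and lower bounds. -/

section Estimates

open scoped Matrix.Norms.Operator

variable {S : Type*} [Fintype S] [DecidableEq S] {Ω : Type*} [MeasurableSpace Ω] {n : ℕ}
  {D : SampleData S Ω n} {μ : Measure Ω} [IsProbabilityMeasure μ] {γ : ℝ} {P M : Matrix S S ℝ}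
  {b : S → ℝ} {ν : S → Measure ℝ}

lemma abs_dotProduct_mulVec_le_sq (M : Matrix S S ℝ) (x y : S → ℝ) :
    |x ⬝ᵥ (M *ᵥ y)| ≤ (Fintype.card S * ‖M‖) * (‖x‖ ^ 2 + ‖y‖ ^ 2) := by
  refine (abs_dotProduct_mulVec_le M x y).trans ?_
  gcongr
  nlinarith [sq_nonneg (‖x‖ - ‖y‖), sq_nonneg ‖x‖, sq_nonneg ‖y‖]

lemma norm_fullErr_sq_le (hγ : γ ∈ Set.Ioo (0 : ℝ) 1) (hP : P ∈ rowStochastic ℝ S)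
    {Q : Matrix S S ℝ} (hQ : Q ∈ rowStochastic ℝ S) (x : S → ℝ) :
    ‖fullErr γ P b Q x‖ ^ 2 ≤ (2 * (1 - γ)⁻¹) ^ 2 * ‖linErr γ P b Q x‖ ^ 2 := by
  rw [← mul_pow]
  exact pow_le_pow_left₀ (norm_nonneg _) (norm_fullErr_le hγ hP hQ x) 2

omit [DecidableEq S] in
lemma norm_add_sq_le_two (x y : S → ℝ) : ‖x + y‖ ^ 2 ≤ 2 * ‖x‖ ^ 2 + 2 * ‖y‖ ^ 2 := by
  calc ‖x + y‖ ^ 2 ≤ (‖x‖ + ‖y‖) ^ 2 := by gcongr; exact norm_add_le x y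
    _ ≤ _ := by nlinarith [sq_nonneg (‖x‖ - ‖y‖)]

/-- The free shifts `c` and `d`, set to `0` or `b`, cover all three terms of the expansion; this is
the origin of the shape `0 + fullErr` below. -/
lemma SampleData.Assumption.integrable_quadratic (h : D.Assumption μ P ν)
    (hγ : γ ∈ Set.Ioo (0 : ℝ) 1) (hP : P ∈ rowStochastic ℝ S) (hn : 0 < n)
    (hν : ∀ i, MemLp id 2 (ν i)) (M : Matrix S S ℝ) (c d : S → ℝ) :
    Integrable (fun ω => (c + fullErr γ P b (D.Phat ω) (D.bhat ω)) ⬝ᵥ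
      (M *ᵥ (d + fullErr γ P b (D.Phat ω) (D.bhat ω)))) μ := by
  refine h.integrable_of_abs_le (γ := γ) (b := b) hn hν
    (fun Q x => (c + fullErr γ P b Q x) ⬝ᵥ (M *ᵥ (d + fullErr γ P b Q x))) (fun Q => ?_)
    ((Fintype.card S * ‖M‖) * (2 * ‖c‖ ^ 2 + 2 * ‖d‖ ^ 2 + 4 * (2 * (1 - γ)⁻¹) ^ 2))
    fun Q hQ x => ?_
  · have h1 : ∀ i, Measurable fun x => fullErr γ P b Q x i :=
      measurable_pi_iff.1 (measurable_fullErr γ P b Q)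
    simp only [mulVec, dotProduct, Pi.add_apply]
    fun_prop
  · refine (abs_dotProduct_mulVec_le_sq _ _ _).trans ?_
    rw [mul_assoc (_ * ‖M‖)]
    refine mul_le_mul_of_nonneg_left ?_ (by positivity)
    have h1 := norm_add_sq_le_two c (fullErr γ P b Q x)
    have h2 := norm_add_sq_le_two d (fullErr γ P b Q x)
    have h3 := norm_fullErr_sq_le (b := b) hγ hP hQ x
    have h4 : 0 ≤ (2 * ‖c‖ ^ 2 + 2 * ‖d‖ ^ 2) * ‖linErr γ P b Q x‖ ^ 2 := by positivity
    have h5 : 0 ≤ (2 * (1 - γ)⁻¹) ^ 2 := sq_nonneg _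
    linarith

omit [IsProbabilityMeasure μ] in
lemma SampleData.Assumption.ae_sqError_eq (h : D.Assumption μ P ν)
    (hγ : γ ∈ Set.Ioo (0 : ℝ) 1) (hP : P ∈ rowStochastic ℝ S) (hn : 0 < n) (hM : M.PosDef)
    (ε : ℝ) :
    sqError D γ P M b ε =ᵐ[μ] fun ω =>
      (0 + fullErr γ P b (D.Phat ω) (D.bhat ω)) ⬝ᵥ
        (M *ᵥ (0 + fullErr γ P b (D.Phat ω) (D.bhat ω)))
      - 2 * (1 - ε) * ((0 + fullErr γ P b (D.Phat ω) (D.bhat ω)) ⬝ᵥ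
        (M *ᵥ (b + fullErr γ P b (D.Phat ω) (D.bhat ω))))
      + (1 - ε) ^ 2 * ((b + fullErr γ P b (D.Phat ω) (D.bhat ω)) ⬝ᵥ
        (M *ᵥ (b + fullErr γ P b (D.Phat ω) (D.bhat ω)))) := by
  filter_upwards [h.ae_mem_rowStochastic hn] with ω hω
  rw [zero_add]
  exact normSq_value_sub hγ hP hω hM _ ε

lemma SampleData.Assumption.integrable_sqError (h : D.Assumption μ P ν)
    (hγ : γ ∈ Set.Ioo (0 : ℝ) 1) (hP : P ∈ rowStochastic ℝ S) (hn : 0 < n) (hM : M.PosDef)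
    (hν : ∀ i, MemLp id 2 (ν i)) (ε : ℝ) : Integrable (sqError D γ P M b ε) μ := by
  rw [integrable_congr (h.ae_sqError_eq hγ hP hn hM ε)]
  exact ((h.integrable_quadratic hγ hP hn hν M 0 0).sub
    ((h.integrable_quadratic hγ hP hn hν M 0 b).const_mul _)).add
    ((h.integrable_quadratic hγ hP hn hν M b b).const_mul _)

/-- The mean square error as a quadratic polynomial in `1 - ε`. -/
lemma SampleData.Assumption.MSE_eq (h : D.Assumption μ P ν)
    (hγ : γ ∈ Set.Ioo (0 : ℝ) 1) (hP : P ∈ rowStochastic ℝ S) (hn : 0 < n) (hM : M.PosDef)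
    (hν : ∀ i, MemLp id 2 (ν i)) (ε : ℝ) :
    MSE μ D γ P M b ε = MSE μ D γ P M b 1
      - 2 * (1 - ε) * ∫ ω, (0 + fullErr γ P b (D.Phat ω) (D.bhat ω)) ⬝ᵥ
        (M *ᵥ (b + fullErr γ P b (D.Phat ω) (D.bhat ω))) ∂μ
      + (1 - ε) ^ 2 * ∫ ω, (b + fullErr γ P b (D.Phat ω) (D.bhat ω)) ⬝ᵥ
        (M *ᵥ (b + fullErr γ P b (D.Phat ω) (D.bhat ω))) ∂μ := by
  have h1 := h.integrable_quadratic (b := b) hγ hP hn hν M 0 0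
  have h2 := h.integrable_quadratic (b := b) hγ hP hn hν M 0 b
  have h3 := h.integrable_quadratic (b := b) hγ hP hn hν M b b
  have key : ∀ ε, MSE μ D γ P M b ε =
      ∫ ω, (0 + fullErr γ P b (D.Phat ω) (D.bhat ω)) ⬝ᵥ
        (M *ᵥ (0 + fullErr γ P b (D.Phat ω) (D.bhat ω))) ∂μ
      - 2 * (1 - ε) * ∫ ω, (0 + fullErr γ P b (D.Phat ω) (D.bhat ω)) ⬝ᵥ
        (M *ᵥ (b + fullErr γ P b (D.Phat ω) (D.bhat ω))) ∂μ
      + (1 - ε) ^ 2 * ∫ ω, (b + fullErr γ P b (D.Phat ω) (D.bhat ω)) ⬝ᵥ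
        (M *ᵥ (b + fullErr γ P b (D.Phat ω) (D.bhat ω))) ∂μ := fun ε => by
    rw [MSE, integral_congr_ae (h.ae_sqError_eq hγ hP hn hM ε), ← integral_const_mul,
      ← integral_const_mul]
    exact (integral_add (h1.sub (h2.const_mul _)) (h3.const_mul _)).trans
      (congrArg (· + _) (integral_sub h1 (h2.const_mul _)))
  rw [key ε, key 1]
  ring

lemma SampleData.Assumption.integral_linErr_dotProduct (h : D.Assumption μ P ν) (hn : 0 < n)
    (hP : P ∈ rowStochastic ℝ S) (hν : ∀ i, MemLp id 2 (ν i))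
    (hb : ∀ i, b i = ∫ x, x ∂(ν i)) (c : S → ℝ) :
    Integrable (fun ω => linErr γ P b (D.Phat ω) (D.bhat ω) ⬝ᵥ c) μ ∧
    ∫ ω, linErr γ P b (D.Phat ω) (D.bhat ω) ⬝ᵥ c ∂μ = 0 := by
  have h1 : ∀ i, Integrable (fun ω => linErr γ P b (D.Phat ω) (D.bhat ω) i * c i) μ :=
    fun i => ((h.memLp_linErr hν i).integrable one_le_two).mul_const _
  simp only [dotProduct]
  refine ⟨integrable_finsetSum _ fun i _ => h1 i, ?_⟩
  rw [integral_finsetSum _ fun i _ => h1 i]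
  simp [integral_mul_const, h.integral_linErr hn hP hν hb]

/-- The first-order term of the mean square error in `1 - ε` is of order `1 / n`. -/
lemma SampleData.Assumption.abs_integral_cross_le (h : D.Assumption μ P ν)
    (hγ : γ ∈ Set.Ioo (0 : ℝ) 1) (hP : P ∈ rowStochastic ℝ S) (hn : 0 < n)
    (hν : ∀ i, MemLp id 2 (ν i)) (hb : ∀ i, b i = ∫ x, x ∂(ν i)) (M : Matrix S S ℝ) :
    |∫ ω, (0 + fullErr γ P b (D.Phat ω) (D.bhat ω)) ⬝ᵥ
        (M *ᵥ (b + fullErr γ P b (D.Phat ω) (D.bhat ω))) ∂μ| ≤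
      (Fintype.card S * ‖M‖) * (2 * (1 - γ)⁻¹ * (‖b‖ + 2 * (1 - γ)⁻¹)) *
        ((Fintype.card S : ℝ) ^ 2 * pertVar γ P + errVar γ P b ν) / n := by
  set κ : ℝ := Fintype.card S * ‖M‖
  set K : ℝ := 2 * (1 - γ)⁻¹
  have hK : 0 ≤ K := by
    have := hγ.2
    have : 0 ≤ 1 - γ := by linarith
    positivity
  have hκ : 0 ≤ κ := by positivity
  obtain ⟨h1, h2⟩ := h.integral_linErr_dotProduct (γ := γ) hn hP hν hb (M *ᵥ b)
  have h3 := h.integrable_quadratic (b := b) hγ hP hn hν M 0 b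
  have h4 := h.integrable_norm_relPert_sq hγ hP hn
  have h5 := h.integrable_norm_linErr_sq (γ := γ) (b := b) hν
  -- The mean-zero term `uᵀ M b` is subtracted before absolute values are taken; bounding it in
  -- absolute value would cost a rate of only `n^(-1/2)`.
  rw [← sub_zero (∫ ω, _ ∂μ), ← h2, ← integral_sub h3 h1]
  calc _ ≤ ∫ ω, |(0 + fullErr γ P b (D.Phat ω) (D.bhat ω)) ⬝ᵥ
        (M *ᵥ (b + fullErr γ P b (D.Phat ω) (D.bhat ω))) -
          linErr γ P b (D.Phat ω) (D.bhat ω) ⬝ᵥ (M *ᵥ b)| ∂μ := abs_integral_le_integral_abs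
    _ ≤ ∫ ω, κ * (K * (‖b‖ + K)) * (‖relPert γ P (D.Phat ω)‖ ^ 2 +
          ‖linErr γ P b (D.Phat ω) (D.bhat ω)‖ ^ 2) ∂μ := by
        refine integral_mono_ae (h3.sub h1).abs ((h4.add h5).const_mul _) ?_
        filter_upwards [h.ae_mem_rowStochastic hn] with ω hω
        have e1 := fullErr_eq (b := b) hγ hP hω (D.bhat ω)
        have e2 := norm_fullErr_sq_le (b := b) hγ hP hω (D.bhat ω)
        set u := linErr γ P b (D.Phat ω) (D.bhat ω)
        set e := fullErr γ P b (D.Phat ω) (D.bhat ω)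
        set z := pertInv γ P (D.Phat ω) *ᵥ (relPert γ P (D.Phat ω) *ᵥ u)
        have e3 : (0 + e) ⬝ᵥ (M *ᵥ (b + e)) - u ⬝ᵥ (M *ᵥ b) =
            e ⬝ᵥ (M *ᵥ e) - z ⬝ᵥ (M *ᵥ b) := by
          rw [zero_add, mulVec_add, dotProduct_add]
          nth_rewrite 1 [e1]
          rw [sub_dotProduct]
          ring
        have e4 : ‖z‖ ≤ K * (‖relPert γ P (D.Phat ω)‖ * ‖u‖) :=
          (linfty_opNorm_mulVec _ _).trans (mul_le_mul (norm_pertInv_le hγ hP hω)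
            (linfty_opNorm_mulVec _ _) (norm_nonneg _) hK)
        have e5 : ‖relPert γ P (D.Phat ω)‖ * ‖u‖ ≤ ‖relPert γ P (D.Phat ω)‖ ^ 2 + ‖u‖ ^ 2 := by
          nlinarith [sq_nonneg (‖relPert γ P (D.Phat ω)‖ - ‖u‖),
            sq_nonneg ‖relPert γ P (D.Phat ω)‖, sq_nonneg ‖u‖]
        rw [e3]
        calc _ ≤ |e ⬝ᵥ (M *ᵥ e)| + |z ⬝ᵥ (M *ᵥ b)| := abs_sub _ _
          _ ≤ κ * (‖e‖ * ‖e‖) + κ * (‖z‖ * ‖b‖) :=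
            add_le_add (abs_dotProduct_mulVec_le M e e) (abs_dotProduct_mulVec_le M z b)
          _ ≤ κ * (K ^ 2 * (‖relPert γ P (D.Phat ω)‖ ^ 2 + ‖u‖ ^ 2)) +
              κ * (K * (‖relPert γ P (D.Phat ω)‖ ^ 2 + ‖u‖ ^ 2) * ‖b‖) := by
            have e6 : ‖e‖ * ‖e‖ ≤ K ^ 2 * (‖relPert γ P (D.Phat ω)‖ ^ 2 + ‖u‖ ^ 2) := by
              rw [← pow_two]
              refine e2.trans ?_
              gcongr
              exact le_add_of_nonneg_left (sq_nonneg _)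
            have e7 : ‖z‖ ≤ K * (‖relPert γ P (D.Phat ω)‖ ^ 2 + ‖u‖ ^ 2) :=
              e4.trans (by gcongr)
            exact add_le_add (mul_le_mul_of_nonneg_left e6 hκ) (mul_le_mul_of_nonneg_left
              (mul_le_mul_of_nonneg_right e7 (norm_nonneg _)) hκ)
          _ = _ := by ring
    _ = κ * (K * (‖b‖ + K)) * (∫ ω, ‖relPert γ P (D.Phat ω)‖ ^ 2 ∂μ +
          ∫ ω, ‖linErr γ P b (D.Phat ω) (D.bhat ω)‖ ^ 2 ∂μ) := by
        rw [integral_const_mul, integral_add h4 h5]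
    _ ≤ κ * (K * (‖b‖ + K)) * ((Fintype.card S : ℝ) ^ 2 * pertVar γ P / n +
          errVar γ P b ν / n) := by
        gcongr
        · exact h.integral_norm_relPert_sq_le hγ hP hn
        · exact h.integral_norm_linErr_sq_le hn hP hν hb
    _ = _ := by ring

/-- Boundedness in `n` is enough, since this term is multiplied by `(1 - ε)²`. -/
lemma SampleData.Assumption.abs_integral_quadratic_le (h : D.Assumption μ P ν)
    (hγ : γ ∈ Set.Ioo (0 : ℝ) 1) (hP : P ∈ rowStochastic ℝ S) (hn : 0 < n)
    (hν : ∀ i, MemLp id 2 (ν i)) (hb : ∀ i, b i = ∫ x, x ∂(ν i)) (M : Matrix S S ℝ) :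
    |∫ ω, (b + fullErr γ P b (D.Phat ω) (D.bhat ω)) ⬝ᵥ
        (M *ᵥ (b + fullErr γ P b (D.Phat ω) (D.bhat ω))) ∂μ| ≤
      (Fintype.card S * ‖M‖) * (4 * ‖b‖ ^ 2 + 4 * (2 * (1 - γ)⁻¹) ^ 2 * errVar γ P b ν) := by
  set κ : ℝ := Fintype.card S * ‖M‖
  set K : ℝ := 2 * (1 - γ)⁻¹
  have h3 := h.integrable_quadratic (b := b) hγ hP hn hν M b b
  have h5 := h.integrable_norm_linErr_sq (γ := γ) (b := b) hν
  have h6 : errVar γ P b ν / n ≤ errVar γ P b ν :=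
    div_le_self (errVar_nonneg hP γ b ν) (by exact_mod_cast hn)
  calc _ ≤ ∫ ω, |(b + fullErr γ P b (D.Phat ω) (D.bhat ω)) ⬝ᵥ
        (M *ᵥ (b + fullErr γ P b (D.Phat ω) (D.bhat ω)))| ∂μ := abs_integral_le_integral_abs
    _ ≤ ∫ ω, κ * (4 * ‖b‖ ^ 2 + 4 * K ^ 2 *
          ‖linErr γ P b (D.Phat ω) (D.bhat ω)‖ ^ 2) ∂μ := by
        refine integral_mono_ae h3.abs
          (((integrable_const _).add (h5.const_mul _)).const_mul _) ?_
        filter_upwards [h.ae_mem_rowStochastic hn] with ω hω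
        have e2 := norm_fullErr_sq_le (b := b) hγ hP hω (D.bhat ω)
        have e3 := norm_add_sq_le_two b (fullErr γ P b (D.Phat ω) (D.bhat ω))
        refine (abs_dotProduct_mulVec_le_sq _ _ _).trans ?_
        refine mul_le_mul_of_nonneg_left ?_ (by positivity)
        linarith
    _ = κ * (4 * ‖b‖ ^ 2 + 4 * K ^ 2 * ∫ ω, ‖linErr γ P b (D.Phat ω) (D.bhat ω)‖ ^ 2 ∂μ) := by
        rw [integral_const_mul, integral_add (integrable_const _) (h5.const_mul _),
          integral_const, probReal_univ, one_smul, integral_const_mul]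
    _ ≤ _ := by
        gcongr
        exact (h.integral_norm_linErr_sq_le hn hP hν hb).trans h6

/-- The mean square error is at least of order `1 / n` unless the error variance vanishes. -/
lemma SampleData.Assumption.le_MSE_one (h : D.Assumption μ P ν)
    (hγ : γ ∈ Set.Ioo (0 : ℝ) 1) (hP : P ∈ rowStochastic ℝ S) (hn : 0 < n) (hM : M.PosDef)
    (hν : ∀ i, MemLp id 2 (ν i)) (hb : ∀ i, b i = ∫ x, x ∂(ν i)) {c : ℝ} (hc : 0 ≤ c)
    (hcM : ∀ x : S → ℝ, c * ‖x‖ ^ 2 ≤ x ⬝ᵥ (M *ᵥ x)) :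
    c * (errVar γ P b ν / n) ≤
      Fintype.card S * (1 + 2 * (1 - γ)⁻¹) ^ 2 * MSE μ D γ P M b 1 := by
  have h5 := h.integrable_norm_linErr_sq (γ := γ) (b := b) hν
  have h6 : c * ∫ ω, ‖linErr γ P b (D.Phat ω) (D.bhat ω)‖ ^ 2 ∂μ ≤
      (1 + 2 * (1 - γ)⁻¹) ^ 2 * MSE μ D γ P M b 1 := by
    rw [MSE, ← integral_const_mul, ← integral_const_mul]
    refine integral_mono_ae (h5.const_mul _)
      ((h.integrable_sqError hγ hP hn hM hν 1).const_mul _) ?_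
    filter_upwards [h.ae_mem_rowStochastic hn] with ω hω
    have e1 := norm_linErr_le (b := b) hγ hP hω (D.bhat ω)
    have e2 : sqError D γ P M b 1 ω = fullErr γ P b (D.Phat ω) (D.bhat ω) ⬝ᵥ
        (M *ᵥ fullErr γ P b (D.Phat ω) (D.bhat ω)) := by
      refine (normSq_value_sub hγ hP hω hM _ 1).trans ?_
      ring
    rw [e2]
    calc _ ≤ c * ((1 + 2 * (1 - γ)⁻¹) * ‖fullErr γ P b (D.Phat ω) (D.bhat ω)‖) ^ 2 := by gcongr
      _ = (1 + 2 * (1 - γ)⁻¹) ^ 2 * (c * ‖fullErr γ P b (D.Phat ω) (D.bhat ω)‖ ^ 2) := by ring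
      _ ≤ _ := by gcongr; exact hcM _
  calc _ ≤ c * (Fintype.card S * ∫ ω, ‖linErr γ P b (D.Phat ω) (D.bhat ω)‖ ^ 2 ∂μ) := by
        gcongr
        exact h.le_integral_norm_linErr_sq hn hP hν hb
    _ = Fintype.card S * (c * ∫ ω, ‖linErr γ P b (D.Phat ω) (D.bhat ω)‖ ^ 2 ∂μ) := by ring
    _ ≤ _ := by rw [mul_assoc]; gcongr

end Estimates

/-! ### Numerator and denominator of `ε°`, and the case of vanishing error variance. -/

section Factor

open scoped Matrix.Norms.Operator

variable {S : Type*} [Fintype S] [DecidableEq S] {Ω : Type*} [MeasurableSpace Ω] {n : ℕ}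
  {D : SampleData S Ω n} {μ : Measure Ω} {γ : ℝ} {P M : Matrix S S ℝ}
  {b : S → ℝ} {ν : S → Measure ℝ}

omit [DecidableEq S] in
lemma dotProduct_transpose_mul_mulVec (A B : Matrix S S ℝ) (x y : S → ℝ) :
    x ⬝ᵥ ((Aᵀ * B) *ᵥ y) = (A *ᵥ x) ⬝ᵥ (B *ᵥ y) := by
  rw [← mulVec_mulVec, dotProduct_mulVec, vecMul_transpose]

omit [MeasurableSpace Ω] in
lemma numVar_eq (D : SampleData S Ω n) (hM : M.PosDef) (ω : Ω) :
    numVar D γ P M b ω = b ⬝ᵥ (M *ᵥ b) + b ⬝ᵥ (M *ᵥ (relPert γ P (D.Phat ω) *ᵥ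
      (relPert γ P (D.Phat ω) *ᵥ b))) := by
  have h : Yhat D γ P ω = relPert γ P (D.Phat ω) := rfl
  simp only [numVar, h]
  generalize relPert γ P (D.Phat ω) = Y
  rw [← transpose_pow, add_mulVec, dotProduct_add, smul_mulVec, dotProduct_smul, add_mulVec,
    dotProduct_add, dotProduct_transpose_mul_mulVec, pow_two, ← mulVec_mulVec, ← mulVec_mulVec,
    dotProduct_mulVec_symm hM (Y *ᵥ (Y *ᵥ b)), smul_eq_mul]
  ring

/-- The random matrix `Q̂` as a function of `Ŷ`. -/
noncomputable def weight (M Y : Matrix S S ℝ) : Matrix S S ℝ :=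
  M + Yᵀ * M * Y + M * Y ^ 2 + Yᵀ ^ 2 * M

lemma dotProduct_weight_mulVec (hM : M.PosDef) (Y : Matrix S S ℝ) (x y : S → ℝ) :
    x ⬝ᵥ (weight M Y *ᵥ y) = x ⬝ᵥ (M *ᵥ y) + (Y *ᵥ x) ⬝ᵥ (M *ᵥ (Y *ᵥ y)) +
      x ⬝ᵥ (M *ᵥ (Y *ᵥ (Y *ᵥ y))) + y ⬝ᵥ (M *ᵥ (Y *ᵥ (Y *ᵥ x))) := by
  rw [weight, ← transpose_pow, add_mulVec, add_mulVec, add_mulVec, dotProduct_add, dotProduct_add,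
    dotProduct_add, mul_assoc Yᵀ, dotProduct_transpose_mul_mulVec,
    dotProduct_transpose_mul_mulVec, pow_two, ← mulVec_mulVec, ← mulVec_mulVec, ← mulVec_mulVec,
    ← mulVec_mulVec, dotProduct_mulVec_symm hM (Y *ᵥ (Y *ᵥ x))]

/-- The `1` accounts for `M`, and `3 * K ^ 2` for the three terms quadratic in `Y`. -/
lemma abs_weight_apply_le (hM : M.PosDef) {Y : Matrix S S ℝ} {K : ℝ} (hY : ‖Y‖ ≤ K) (i j : S) :
    |weight M Y i j| ≤ (Fintype.card S * ‖M‖) * (1 + 3 * K ^ 2) := by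
  have hK : 0 ≤ K := (norm_nonneg Y).trans hY
  have h0 : weight M Y i j = Pi.single i 1 ⬝ᵥ (weight M Y *ᵥ Pi.single j 1) := by simp
  rw [h0, dotProduct_weight_mulVec hM]
  have h1 : ∀ i : S, ‖(Pi.single i 1 : S → ℝ)‖ = 1 := fun i => by
    rw [Pi.norm_single, norm_one]
  have h2 : ∀ i : S, ‖Y *ᵥ Pi.single i 1‖ ≤ K := fun i => by
    have := linfty_opNorm_mulVec Y (Pi.single i 1)
    rw [h1, mul_one] at this
    exact this.trans hY
  have h3 : ∀ i : S, ‖Y *ᵥ (Y *ᵥ Pi.single i 1)‖ ≤ K ^ 2 := fun i => by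
    rw [pow_two]
    exact (linfty_opNorm_mulVec Y _).trans (mul_le_mul hY (h2 i) (norm_nonneg _) hK)
  have hκ : (0 : ℝ) ≤ Fintype.card S * ‖M‖ := by positivity
  have a1 := abs_dotProduct_mulVec_le M (Pi.single i 1) (Pi.single j 1)
  have a2 := abs_dotProduct_mulVec_le M (Y *ᵥ Pi.single i 1) (Y *ᵥ Pi.single j 1)
  have a3 := abs_dotProduct_mulVec_le M (Pi.single i 1) (Y *ᵥ (Y *ᵥ Pi.single j 1))
  have a4 := abs_dotProduct_mulVec_le M (Pi.single j 1) (Y *ᵥ (Y *ᵥ Pi.single i 1))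
  rw [h1, h1, one_mul] at a1
  rw [h1, one_mul] at a3 a4
  have b2 := mul_le_mul_of_nonneg_left
    (mul_le_mul (h2 i) (h2 j) (norm_nonneg _) hK) hκ
  have b3 := mul_le_mul_of_nonneg_left (h3 j) hκ
  have b4 := mul_le_mul_of_nonneg_left (h3 i) hκ
  refine (abs_add_le _ _).trans ?_
  have c1 := abs_add_le (Pi.single i 1 ⬝ᵥ (M *ᵥ Pi.single j 1) +
    (Y *ᵥ Pi.single i 1) ⬝ᵥ (M *ᵥ (Y *ᵥ Pi.single j 1)))
    (Pi.single i 1 ⬝ᵥ (M *ᵥ (Y *ᵥ (Y *ᵥ Pi.single j 1))))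
  have c2 := abs_add_le (Pi.single i 1 ⬝ᵥ (M *ᵥ Pi.single j 1))
    ((Y *ᵥ Pi.single i 1) ⬝ᵥ (M *ᵥ (Y *ᵥ Pi.single j 1)))
  linarith

lemma denVar_eq (μ : Measure Ω) (D : SampleData S Ω n) (hM : M.PosDef) (ω : Ω) :
    denVar μ D γ P M b ω = b ⬝ᵥ (M *ᵥ b) +
      (relPert γ P (D.Phat ω) *ᵥ b) ⬝ᵥ (M *ᵥ (relPert γ P (D.Phat ω) *ᵥ b)) +
      2 * (b ⬝ᵥ (M *ᵥ (relPert γ P (D.Phat ω) *ᵥ (relPert γ P (D.Phat ω) *ᵥ b)))) +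
      (covBhat μ D * weight M (relPert γ P (D.Phat ω))).trace := by
  have h : denVar μ D γ P M b ω = b ⬝ᵥ (weight M (relPert γ P (D.Phat ω)) *ᵥ b) +
      (covBhat μ D * weight M (relPert γ P (D.Phat ω))).trace := rfl
  rw [h, dotProduct_weight_mulVec hM]
  ring

variable [IsProbabilityMeasure μ]

/-- The total bound for the entries of the covariance matrix of a single reward vector. -/
noncomputable def covBound (ν : S → Measure ℝ) : ℝ := ∑ i, ∑ j, (Var[id; ν i] + Var[id; ν j])

lemma SampleData.Assumption.abs_trace_le (h : D.Assumption μ P ν)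
    (hγ : γ ∈ Set.Ioo (0 : ℝ) 1) (hP : P ∈ rowStochastic ℝ S) (hn : 0 < n) (hM : M.PosDef)
    (hν : ∀ i, MemLp id 2 (ν i)) {Q : Matrix S S ℝ} (hQ : Q ∈ rowStochastic ℝ S) :
    |(covBhat μ D * weight M (relPert γ P Q)).trace| ≤
      covBound ν / n * ((Fintype.card S * ‖M‖) * (1 + 3 * (2 * (1 - γ)⁻¹) ^ 2)) := by
  simp only [Matrix.trace, Matrix.diag, Matrix.mul_apply, covBound, Finset.sum_div,
    Finset.sum_mul]
  refine (Finset.abs_sum_le_sum_abs _ _).trans (Finset.sum_le_sum fun i _ => ?_)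
  refine (Finset.abs_sum_le_sum_abs _ _).trans (Finset.sum_le_sum fun j _ => ?_)
  rw [abs_mul]
  have h1 := h.abs_covBhat_le hn hν i j
  exact mul_le_mul h1 (abs_weight_apply_le hM (norm_relPert_le hγ hP hQ) j i) (abs_nonneg _)
    ((abs_nonneg _).trans h1)

lemma abs_quadratic_relPert_le (γ : ℝ) (P Q M : Matrix S S ℝ) (b : S → ℝ) :
    |(relPert γ P Q *ᵥ b) ⬝ᵥ (M *ᵥ (relPert γ P Q *ᵥ b))| ≤
      (Fintype.card S * ‖M‖) * ‖b‖ ^ 2 * ‖relPert γ P Q‖ ^ 2 ∧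
    |b ⬝ᵥ (M *ᵥ (relPert γ P Q *ᵥ (relPert γ P Q *ᵥ b)))| ≤
      (Fintype.card S * ‖M‖) * ‖b‖ ^ 2 * ‖relPert γ P Q‖ ^ 2 := by
  set Y := relPert γ P Q
  have h1 := linfty_opNorm_mulVec Y b
  have h2 : ‖Y *ᵥ (Y *ᵥ b)‖ ≤ ‖Y‖ * (‖Y‖ * ‖b‖) :=
    (linfty_opNorm_mulVec Y _).trans (by gcongr)
  constructor
  · calc _ ≤ _ := abs_dotProduct_mulVec_le _ _ _
      _ ≤ (Fintype.card S * ‖M‖) * ((‖Y‖ * ‖b‖) * (‖Y‖ * ‖b‖)) := by gcongr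
      _ = _ := by ring
  · calc _ ≤ _ := abs_dotProduct_mulVec_le _ _ _
      _ ≤ (Fintype.card S * ‖M‖) * (‖b‖ * (‖Y‖ * (‖Y‖ * ‖b‖))) := by gcongr
      _ = _ := by ring

lemma SampleData.Assumption.integrable_numVar (h : D.Assumption μ P ν)
    (hγ : γ ∈ Set.Ioo (0 : ℝ) 1) (hP : P ∈ rowStochastic ℝ S) (hn : 0 < n) (hM : M.PosDef) :
    Integrable (numVar D γ P M b) μ := by
  rw [integrable_congr (Eventually.of_forall (numVar_eq D hM))]
  refine (integrable_const _).add (((h.integrable_norm_relPert_sq hγ hP hn).const_mul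
    ((Fintype.card S * ‖M‖) * ‖b‖ ^ 2)).mono' ?_ (Eventually.of_forall fun ω => ?_))
  · exact (h.aemeasurable_estimates
      (fun Q _ => b ⬝ᵥ (M *ᵥ (relPert γ P Q *ᵥ (relPert γ P Q *ᵥ b))))
      fun Q => measurable_const).aestronglyMeasurable
  · exact (abs_quadratic_relPert_le γ P (D.Phat ω) M b).2

lemma SampleData.Assumption.integrable_denVar (h : D.Assumption μ P ν)
    (hγ : γ ∈ Set.Ioo (0 : ℝ) 1) (hP : P ∈ rowStochastic ℝ S) (hn : 0 < n) (hM : M.PosDef)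
    (hν : ∀ i, MemLp id 2 (ν i)) :
    Integrable (denVar μ D γ P M b) μ := by
  rw [integrable_congr (Eventually.of_forall (denVar_eq μ D hM))]
  have h1 := (h.integrable_norm_relPert_sq hγ hP hn).const_mul
    ((Fintype.card S * ‖M‖) * ‖b‖ ^ 2)
  refine (((integrable_const _).add (h1.mono' ?_ ?_)).add
    ((h1.mono' ?_ ?_).const_mul 2)).add ((integrable_const (covBound ν / n *
      ((Fintype.card S * ‖M‖) * (1 + 3 * (2 * (1 - γ)⁻¹) ^ 2)))).mono' ?_ ?_)
  · exact (h.aemeasurable_estimates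
      (fun Q _ => (relPert γ P Q *ᵥ b) ⬝ᵥ (M *ᵥ (relPert γ P Q *ᵥ b)))
      fun Q => measurable_const).aestronglyMeasurable
  · exact Eventually.of_forall fun ω => (abs_quadratic_relPert_le γ P (D.Phat ω) M b).1
  · exact (h.aemeasurable_estimates
      (fun Q _ => b ⬝ᵥ (M *ᵥ (relPert γ P Q *ᵥ (relPert γ P Q *ᵥ b))))
      fun Q => measurable_const).aestronglyMeasurable
  · exact Eventually.of_forall fun ω => (abs_quadratic_relPert_le γ P (D.Phat ω) M b).2
  · exact (h.aemeasurable_estimates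
      (fun Q _ => (covBhat μ D * weight M (relPert γ P Q)).trace)
      fun Q => measurable_const).aestronglyMeasurable
  · filter_upwards [h.ae_mem_rowStochastic hn] with ω hω
    exact h.abs_trace_le hγ hP hn hM hν hω

/-- The constant in the bounds for the numerator and the denominator of `ε°`. -/
noncomputable def factorBound (γ : ℝ) (P M : Matrix S S ℝ) (b : S → ℝ) (ν : S → Measure ℝ) : ℝ :=
  3 * ((Fintype.card S * ‖M‖) * ‖b‖ ^ 2) * ((Fintype.card S : ℝ) ^ 2 * pertVar γ P) +
    covBound ν * ((Fintype.card S * ‖M‖) * (1 + 3 * (2 * (1 - γ)⁻¹) ^ 2))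

lemma SampleData.Assumption.abs_integral_le_factorBound (h : D.Assumption μ P ν)
    (hγ : γ ∈ Set.Ioo (0 : ℝ) 1) (hP : P ∈ rowStochastic ℝ S) (hn : 0 < n) (f : Ω → ℝ)
    (hf : ∀ᵐ ω ∂μ, |f ω| ≤ 3 * ((Fintype.card S * ‖M‖) * ‖b‖ ^ 2) *
      ‖relPert γ P (D.Phat ω)‖ ^ 2 +
        covBound ν / n * ((Fintype.card S * ‖M‖) * (1 + 3 * (2 * (1 - γ)⁻¹) ^ 2))) :
    |∫ ω, f ω ∂μ| ≤ factorBound γ P M b ν / n := by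
  have h1 := (h.integrable_norm_relPert_sq hγ hP hn).const_mul
    (3 * ((Fintype.card S * ‖M‖) * ‖b‖ ^ 2))
  have h2 : Integrable (fun ω => 3 * ((Fintype.card S * ‖M‖) * ‖b‖ ^ 2) *
      ‖relPert γ P (D.Phat ω)‖ ^ 2 + covBound ν / n *
        ((Fintype.card S * ‖M‖) * (1 + 3 * (2 * (1 - γ)⁻¹) ^ 2))) μ :=
    h1.add (integrable_const _)
  refine (norm_integral_le_of_norm_le (f := f) h2 hf).trans ?_
  have h3 := integral_add h1 (integrable_const (μ := μ) (covBound ν / n *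
    ((Fintype.card S * ‖M‖) * (1 + 3 * (2 * (1 - γ)⁻¹) ^ 2))))
  refine h3.le.trans ?_
  rw [integral_const_mul, integral_const, probReal_univ, one_smul]
  calc _ ≤ 3 * ((Fintype.card S * ‖M‖) * ‖b‖ ^ 2) *
        ((Fintype.card S : ℝ) ^ 2 * pertVar γ P / n) + _ := by
        gcongr
        exact h.integral_norm_relPert_sq_le hγ hP hn
    _ = _ := by rw [factorBound]; ring

lemma SampleData.Assumption.abs_integral_denVar_sub_le (h : D.Assumption μ P ν)
    (hγ : γ ∈ Set.Ioo (0 : ℝ) 1) (hP : P ∈ rowStochastic ℝ S) (hn : 0 < n) (hM : M.PosDef)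
    (hν : ∀ i, MemLp id 2 (ν i)) :
    |∫ ω, denVar μ D γ P M b ω ∂μ - b ⬝ᵥ (M *ᵥ b)| ≤ factorBound γ P M b ν / n := by
  have h1 : ∫ ω, denVar μ D γ P M b ω ∂μ - b ⬝ᵥ (M *ᵥ b) =
      ∫ ω, (denVar μ D γ P M b ω - b ⬝ᵥ (M *ᵥ b)) ∂μ := by
    rw [integral_sub (h.integrable_denVar hγ hP hn hM hν) (integrable_const _)]
    simp
  rw [h1]
  refine h.abs_integral_le_factorBound hγ hP hn _ ?_
  filter_upwards [h.ae_mem_rowStochastic hn] with ω hω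
  obtain ⟨e1, e2⟩ := abs_quadratic_relPert_le γ P (D.Phat ω) M b
  have e3 := h.abs_trace_le hγ hP hn hM hν hω
  rw [denVar_eq μ D hM]
  rw [abs_le] at *
  constructor <;> linarith

lemma SampleData.Assumption.abs_integral_denVar_sub_numVar_le (h : D.Assumption μ P ν)
    (hγ : γ ∈ Set.Ioo (0 : ℝ) 1) (hP : P ∈ rowStochastic ℝ S) (hn : 0 < n) (hM : M.PosDef)
    (hν : ∀ i, MemLp id 2 (ν i)) :
    |∫ ω, denVar μ D γ P M b ω ∂μ - ∫ ω, numVar D γ P M b ω ∂μ| ≤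
      factorBound γ P M b ν / n := by
  rw [← integral_sub (h.integrable_denVar hγ hP hn hM hν) (h.integrable_numVar hγ hP hn hM)]
  refine h.abs_integral_le_factorBound hγ hP hn _ ?_
  filter_upwards [h.ae_mem_rowStochastic hn] with ω hω
  obtain ⟨e1, e2⟩ := abs_quadratic_relPert_le γ P (D.Phat ω) M b
  have e3 := h.abs_trace_le hγ hP hn hM hν hω
  -- Only two terms quadratic in `Y` survive in the difference; `e4` fills the gap to the shared
  -- coefficient `3`.
  have e4 := (abs_nonneg _).trans e1
  rw [denVar_eq μ D hM, numVar_eq D hM]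
  rw [abs_le] at *
  constructor <;> linarith

lemma errVar_eq_zero (hP : P ∈ rowStochastic ℝ S) (h0 : errVar γ P b ν = 0) (i : S) :
    Var[id; ν i] = 0 ∧ γ ^ 2 * rowVar P ((opA γ P)⁻¹ *ᵥ b) i = 0 := by
  have h1 : ∀ i, 0 ≤ γ ^ 2 * rowVar P ((opA γ P)⁻¹ *ᵥ b) i := fun i =>
    mul_nonneg (sq_nonneg _) (rowVar_nonneg hP _ i)
  have h2 := (Finset.sum_eq_zero_iff_of_nonneg fun i _ =>
    add_nonneg (variance_nonneg id (ν i)) (h1 i)).1 h0 i (Finset.mem_univ i)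
  exact (add_eq_zero_iff_of_nonneg (variance_nonneg _ _) (h1 i)).1 h2

/-- Without error variance, the numerator and the denominator of `ε°` agree. -/
lemma SampleData.Assumption.integral_denVar_eq_of_errVar_eq_zero (h : D.Assumption μ P ν)
    (hP : P ∈ rowStochastic ℝ S) (hn : 0 < n) (hM : M.PosDef)
    (hν : ∀ i, MemLp id 2 (ν i)) (h0 : errVar γ P b ν = 0) :
    ∫ ω, denVar μ D γ P M b ω ∂μ = ∫ ω, numVar D γ P M b ω ∂μ := by
  have hcov : covBhat μ D = 0 := by
    ext i j
    have h1 := h.abs_covBhat_le hn hν i j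
    rw [(errVar_eq_zero hP h0 i).1, (errVar_eq_zero hP h0 j).1, add_zero, zero_div] at h1
    exact abs_nonpos_iff.1 h1
  have hY : ∀ᵐ ω ∂μ, ∀ i, (relPert γ P (D.Phat ω) *ᵥ b) i = 0 := by
    rw [ae_all_iff]
    intro i
    have h1 := h.integral_relPert_mulVec_sq (γ := γ) hn hP b i
    rw [(errVar_eq_zero hP h0 i).2, zero_div, integral_eq_zero_iff_of_nonneg
      (fun ω => sq_nonneg _) (h.memLp_relPert_mulVec b i).integrable_sq] at h1
    filter_upwards [h1] with ω hω
    exact pow_eq_zero_iff two_ne_zero |>.1 hω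
  refine integral_congr_ae ?_
  filter_upwards [hY] with ω hω
  have h2 : relPert γ P (D.Phat ω) *ᵥ b = 0 := funext hω
  rw [denVar_eq μ D hM, numVar_eq D hM, hcov, h2]
  simp

lemma SampleData.Assumption.MSE_one_eq_zero (h : D.Assumption μ P ν)
    (hγ : γ ∈ Set.Ioo (0 : ℝ) 1) (hP : P ∈ rowStochastic ℝ S) (hn : 0 < n) (hM : M.PosDef)
    (hν : ∀ i, MemLp id 2 (ν i)) (hb : ∀ i, b i = ∫ x, x ∂(ν i)) (h0 : errVar γ P b ν = 0) :
    MSE μ D γ P M b 1 = 0 := by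
  have h1 := h.integral_norm_linErr_sq_le (γ := γ) hn hP hν hb
  rw [h0, zero_div] at h1
  have h2 := h1.antisymm (integral_nonneg fun ω => sq_nonneg _)
  rw [integral_eq_zero_iff_of_nonneg (fun ω => sq_nonneg _)
    (h.integrable_norm_linErr_sq hν)] at h2
  refine integral_eq_zero_of_ae ?_
  filter_upwards [h2, h.ae_mem_rowStochastic hn] with ω h3 hω
  have h4 : linErr γ P b (D.Phat ω) (D.bhat ω) = 0 :=
    norm_eq_zero.1 (pow_eq_zero_iff two_ne_zero |>.1 h3)
  refine (normSq_value_sub hγ hP hω hM _ 1).trans ?_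
  simp [fullErr, h4]

end Factor

/-! ### Assembly of the rate. -/

section Rate

open scoped Matrix.Norms.Operator

variable {S : Type*} [Fintype S] [DecidableEq S] {Ω : Type*} [MeasurableSpace Ω] {n : ℕ}
  {D : SampleData S Ω n} {μ : Measure Ω} [IsProbabilityMeasure μ] {γ : ℝ} {P M : Matrix S S ℝ}
  {b : S → ℝ} {ν : S → Measure ℝ}

lemma SampleData.Assumption.half_le_integral_denVar (h : D.Assumption μ P ν)
    (hγ : γ ∈ Set.Ioo (0 : ℝ) 1) (hP : P ∈ rowStochastic ℝ S) (hn : 0 < n) (hM : M.PosDef)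
    (hν : ∀ i, MemLp id 2 (ν i))
    (hlarge : factorBound γ P M b ν / n ≤ b ⬝ᵥ (M *ᵥ b) / 2) :
    b ⬝ᵥ (M *ᵥ b) / 2 ≤ ∫ ω, denVar μ D γ P M b ω ∂μ := by
  have h1 := abs_le.1 (h.abs_integral_denVar_sub_le (b := b) hγ hP hn hM hν)
  linarith [h1.1]

lemma SampleData.Assumption.abs_one_sub_epsCirc_le (h : D.Assumption μ P ν)
    (hγ : γ ∈ Set.Ioo (0 : ℝ) 1) (hP : P ∈ rowStochastic ℝ S) (hn : 0 < n) (hM : M.PosDef)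
    (hν : ∀ i, MemLp id 2 (ν i)) (hb0 : 0 < b ⬝ᵥ (M *ᵥ b))
    (hlarge : factorBound γ P M b ν / n ≤ b ⬝ᵥ (M *ᵥ b) / 2) :
    |1 - epsCirc μ D γ P M b| ≤ factorBound γ P M b ν / (b ⬝ᵥ (M *ᵥ b) / 2) / n := by
  have h1 := h.half_le_integral_denVar hγ hP hn hM hν hlarge
  have h2 := h.abs_integral_denVar_sub_numVar_le (b := b) hγ hP hn hM hν
  have h3 : 0 < ∫ ω, denVar μ D γ P M b ω ∂μ := by linarith
  rw [epsCirc, one_sub_div h3.ne', abs_div, abs_of_pos h3, div_right_comm]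
  exact div_le_div₀ ((abs_nonneg _).trans h2) h2 (by linarith) h1

lemma SampleData.Assumption.epsCirc_eq_one (h : D.Assumption μ P ν)
    (hγ : γ ∈ Set.Ioo (0 : ℝ) 1) (hP : P ∈ rowStochastic ℝ S) (hn : 0 < n) (hM : M.PosDef)
    (hν : ∀ i, MemLp id 2 (ν i)) (hb0 : 0 < b ⬝ᵥ (M *ᵥ b))
    (hlarge : factorBound γ P M b ν / n ≤ b ⬝ᵥ (M *ᵥ b) / 2) (h0 : errVar γ P b ν = 0) :
    epsCirc μ D γ P M b = 1 := by
  have h1 := h.half_le_integral_denVar hγ hP hn hM hν hlarge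
  have h3 : 0 < ∫ ω, denVar μ D γ P M b ω ∂μ := by linarith
  rw [epsCirc, ← h.integral_denVar_eq_of_errVar_eq_zero hP hn hM hν h0, div_self h3.ne']

/-- The constant in the bound for the first-order term of the mean square error. -/
noncomputable def crossBound (γ : ℝ) (P M : Matrix S S ℝ) (b : S → ℝ) (ν : S → Measure ℝ) : ℝ :=
  (Fintype.card S * ‖M‖) * (2 * (1 - γ)⁻¹ * (‖b‖ + 2 * (1 - γ)⁻¹)) *
    ((Fintype.card S : ℝ) ^ 2 * pertVar γ P + errVar γ P b ν)

/-- The constant in the bound for the second-order term of the mean square error. -/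
noncomputable def quadBound (γ : ℝ) (P M : Matrix S S ℝ) (b : S → ℝ) (ν : S → Measure ℝ) : ℝ :=
  (Fintype.card S * ‖M‖) * (4 * ‖b‖ ^ 2 + 4 * (2 * (1 - γ)⁻¹) ^ 2 * errVar γ P b ν)

/-- Each term carries two factors `1 / n`: one from `1 - ε` and one from the cross expectation, or
both from `(1 - ε)²`. -/
lemma SampleData.Assumption.abs_MSE_sub_le (h : D.Assumption μ P ν)
    (hγ : γ ∈ Set.Ioo (0 : ℝ) 1) (hP : P ∈ rowStochastic ℝ S) (hn : 0 < n) (hM : M.PosDef)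
    (hν : ∀ i, MemLp id 2 (ν i)) (hb : ∀ i, b i = ∫ x, x ∂(ν i)) {ε c : ℝ}
    (hε : |1 - ε| ≤ c / n) :
    |MSE μ D γ P M b 1 - MSE μ D γ P M b ε| ≤
      (2 * c * crossBound γ P M b ν + c ^ 2 * quadBound γ P M b ν) / n ^ 2 := by
  have h1 := h.abs_integral_cross_le hγ hP hn hν hb M
  have h2 := h.abs_integral_quadratic_le hγ hP hn hν hb M
  have hc := (abs_nonneg _).trans hε
  rw [h.MSE_eq hγ hP hn hM hν ε]
  set B := ∫ ω, (0 + fullErr γ P b (D.Phat ω) (D.bhat ω)) ⬝ᵥ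
        (M *ᵥ (b + fullErr γ P b (D.Phat ω) (D.bhat ω))) ∂μ
  set C := ∫ ω, (b + fullErr γ P b (D.Phat ω) (D.bhat ω)) ⬝ᵥ
        (M *ᵥ (b + fullErr γ P b (D.Phat ω) (D.bhat ω))) ∂μ
  calc _ = |2 * ((1 - ε) * B) - (1 - ε) ^ 2 * C| := by congr 1; ring
    _ ≤ |2 * ((1 - ε) * B)| + |(1 - ε) ^ 2 * C| := abs_sub _ _
    _ = 2 * (|1 - ε| * |B|) + |1 - ε| ^ 2 * |C| := by
      rw [abs_mul, abs_mul, abs_mul, abs_pow, abs_two]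
    _ ≤ 2 * (c / n * (crossBound γ P M b ν / n)) + (c / n) ^ 2 * quadBound γ P M b ν := by
      gcongr
      · exact h1
      · exact h2
    _ = _ := by
      have : (n : ℝ) ≠ 0 := by positivity
      field_simp

lemma SampleData.Assumption.abs_relReduction_le (h : D.Assumption μ P ν)
    (hγ : γ ∈ Set.Ioo (0 : ℝ) 1) (hP : P ∈ rowStochastic ℝ S) (hn : 0 < n) (hM : M.PosDef)
    (hν : ∀ i, MemLp id 2 (ν i)) (hb : ∀ i, b i = ∫ x, x ∂(ν i)) {c d : ℝ}
    (hε : |1 - epsCirc μ D γ P M b| ≤ d / n) (hc : 0 < c)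
    (hcM : ∀ x : S → ℝ, c * ‖x‖ ^ 2 ≤ x ⬝ᵥ (M *ᵥ x)) (hV : 0 < errVar γ P b ν) :
    0 < MSE μ D γ P M b 1 ∧ |relReduction μ D γ P M b| ≤
      (2 * d * crossBound γ P M b ν + d ^ 2 * quadBound γ P M b ν) *
        (Fintype.card S * (1 + 2 * (1 - γ)⁻¹) ^ 2) / (c * errVar γ P b ν) * (1 / n) := by
  have h1 := h.abs_MSE_sub_le hγ hP hn hM hν hb hε
  have h2 := h.le_MSE_one hγ hP hn hM hν hb hc.le hcM
  set L : ℝ := Fintype.card S * (1 + 2 * (1 - γ)⁻¹) ^ 2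
  set X := 2 * d * crossBound γ P M b ν + d ^ 2 * quadBound γ P M b ν
  have hn' : (0 : ℝ) < n := by exact_mod_cast hn
  have hL : 0 ≤ L := by positivity
  have h3 : 0 < c * (errVar γ P b ν / n) := by positivity
  have h4 : 0 < MSE μ D γ P M b 1 := pos_of_mul_pos_right (h3.trans_le h2) hL
  have hX : 0 ≤ X := by
    have := (abs_nonneg _).trans h1
    rwa [le_div_iff₀ (by positivity), zero_mul] at this
  refine ⟨h4, ?_⟩
  rw [relReduction, abs_div, abs_of_pos h4, div_le_iff₀ h4]
  calc _ ≤ X / n ^ 2 := h1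
    -- One factor `1 / n` is traded for the lower bound on `MSE(1)`; the other is the rate.
    _ = X / (c * errVar γ P b ν * n) * (c * (errVar γ P b ν / n)) := by field_simp
    _ ≤ X / (c * errVar γ P b ν * n) * (L * MSE μ D γ P M b 1) := by gcongr
    _ = _ := by field_simp

end Rate

end PolicyEval

theorem mainTheorem5 {S : Type*} [Fintype S] [DecidableEq S]
    (γ : ℝ) (hγ : γ ∈ Set.Ioo (0 : ℝ) 1)
    (P : Matrix S S ℝ) (hP : P ∈ Matrix.rowStochastic ℝ S)
    (M : Matrix S S ℝ) (hM : M.PosDef)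
    (ν : S → Measure ℝ) (hν : ∀ i, MemLp id 2 (ν i))
    (b : S → ℝ) (hb : ∀ i, b i = ∫ x, x ∂(ν i)) (hb0 : b ≠ 0)
    {Ω : ℕ → Type*} [∀ n, MeasurableSpace (Ω n)]
    (μ : ∀ n, Measure (Ω n)) [∀ n, IsProbabilityMeasure (μ n)]
    (D : ∀ n, PolicyEval.SampleData S (Ω n) n)
    (hD : ∀ n, 0 < n → (D n).Assumption (μ n) P ν) :
    -- all expectations involved are finite
    (∀ n, 0 < n →
      (∀ ε, Integrable (PolicyEval.sqError (D n) γ P M b ε) (μ n)) ∧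
      Integrable (PolicyEval.numVar (D n) γ P M b) (μ n) ∧
      Integrable (PolicyEval.denVar (μ n) (D n) γ P M b) (μ n)) ∧
    -- for large `n`, the quotients defining `ε°` and `η` make sense, except that `η` has the form
    -- `0 / 0` (read as `0`) when the unaugmented estimate has no error
    (∀ᶠ n in atTop,
      0 < ∫ ω, PolicyEval.denVar (μ n) (D n) γ P M b ω ∂(μ n) ∧
      (PolicyEval.MSE (μ n) (D n) γ P M b 1 = 0 →
        PolicyEval.MSE (μ n) (D n) γ P M b
          (PolicyEval.epsCirc (μ n) (D n) γ P M b) = 0)) ∧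
    -- the rate
    (fun n => PolicyEval.relReduction (μ n) (D n) γ P M b) =O[atTop] fun n : ℕ => 1 / (n : ℝ) := by
  have hβ : 0 < b ⬝ᵥ (M *ᵥ b) := by simpa using hM.dotProduct_mulVec_pos hb0
  -- Beyond this threshold the denominator of `ε°` is at least half its limit `bᵀ M b`.
  have hlarge : ∀ᶠ n : ℕ in atTop,
      0 < n ∧ PolicyEval.factorBound γ P M b ν / n ≤ b ⬝ᵥ (M *ᵥ b) / 2 :=
    (eventually_gt_atTop 0).and
      ((tendsto_const_div_atTop_nhds_zero_nat _).eventually_le_const (half_pos hβ))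
  obtain ⟨c, hc, hcM⟩ := PolicyEval.exists_pos_mul_norm_sq_le hM
  refine ⟨fun n hn => ⟨fun ε => (hD n hn).integrable_sqError hγ hP hn hM hν ε,
    (hD n hn).integrable_numVar hγ hP hn hM, (hD n hn).integrable_denVar hγ hP hn hM hν⟩, ?_, ?_⟩
  · filter_upwards [hlarge] with n ⟨hn, hl⟩
    refine ⟨(half_pos hβ).trans_le ((hD n hn).half_le_integral_denVar hγ hP hn hM hν hl),
      fun h0 => ?_⟩
    rcases (PolicyEval.errVar_nonneg hP γ b ν).eq_or_lt with hV | hV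
    · rw [(hD n hn).epsCirc_eq_one hγ hP hn hM hν hβ hl hV.symm, h0]
    · exact absurd h0 ((hD n hn).abs_relReduction_le hγ hP hn hM hν hb
        ((hD n hn).abs_one_sub_epsCirc_le hγ hP hn hM hν hβ hl) hc hcM hV).1.ne'
  · rcases (PolicyEval.errVar_nonneg hP γ b ν).eq_or_lt with hV | hV
    -- Here `MSE(1) = 0`, so the quotient is `0` by the convention for division by zero.
    · refine IsBigO.of_bound 0 ?_
      filter_upwards [hlarge] with n ⟨hn, hl⟩
      rw [PolicyEval.relReduction, (hD n hn).MSE_one_eq_zero hγ hP hn hM hν hb hV.symm]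
      simp
    · set d := PolicyEval.factorBound γ P M b ν / (b ⬝ᵥ (M *ᵥ b) / 2)
      refine IsBigO.of_bound
        ((2 * d * PolicyEval.crossBound γ P M b ν + d ^ 2 * PolicyEval.quadBound γ P M b ν) *
          (Fintype.card S * (1 + 2 * (1 - γ)⁻¹) ^ 2) / (c * PolicyEval.errVar γ P b ν)) ?_
      filter_upwards [hlarge] with n ⟨hn, hl⟩
      rw [Real.norm_of_nonneg (by positivity : (0 : ℝ) ≤ 1 / n)]
      exact ((hD n hn).abs_relReduction_le hγ hP hn hM hν hb
        ((hD n hn).abs_one_sub_epsCirc_le hγ hP hn hM hν hβ hl) hc hcM hV).2
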